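/- Let $AG(4,3)$ be the four-dimensional affine space over the field $\mathbb F_3$, whose points are the vectors of $\mathbb F_3^4$; three distinct points form a line if and only if they sum to $\vec 0$, and a hyperplane is a three-dimensional affine subspace. A cap is a set of points containing no line, and a maximal cap is a cap of the largest possible cardinality in $AG(4,3)$. For a point $a$, an $a$-line is a pair of points $\{b,c\}$ such that $\{a,b,c\}$ is a line. A demicap with anchor point $a$ is a cap in $AG(4,3)$ that is the union of five distinct $a$-lines such that no hyperplane contains the lines $\{a,b,c\}$ given by four of these $a$-lines $\{b,c\}$; a demicap is a set that is a demicap with some anchor point. Then: 1. For every point $a$ of $AG(4,3)$ there are exactly $101{,}088$ demicaps with anchor point $a$. 2. Every maximal cap $C$ in $AG(4,3)$ contains exactly $72$ demicaps (that is, exactly $72$ demicaps are subsets of $C$). 3. Every demicap is contained in exactly $6$ maximal caps. -/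

import Mathlib

/-- The points of the affine geometry `AG(n,3)`: the vectors of an `n`-dimensional vector space
over the field with three elements. -/
abbrev AG (n : ℕ) : Type := Fin n → ZMod 3

/-- `{x, y, z}` is a line of `AG(n,3)`: three distinct points whose vectors sum to zero. -/
def IsLine {n : ℕ} (x y z : AG n) : Prop :=
  x ≠ y ∧ x ≠ z ∧ y ≠ z ∧ x + y + z = 0

/-- A cap: a set of points containing no lines. -/
def IsCap {n : ℕ} (C : Finset (AG n)) : Prop :=
  ∀ x ∈ C, ∀ y ∈ C, ∀ z ∈ C, ¬ IsLine x y z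

/-- A maximal cap: a cap of largest possible size (not merely maximal under inclusion). -/
def IsMaximalCap {n : ℕ} (C : Finset (AG n)) : Prop :=
  IsCap C ∧ ∀ C' : Finset (AG n), IsCap C' → C'.card ≤ C.card

/-- An affine hyperplane: an affine subspace of dimension `n - 1`. -/
def IsHyperplane {n : ℕ} (H : AffineSubspace (ZMod 3) (AG n)) : Prop :=
  (H : Set (AG n)).Nonempty ∧ Module.finrank (ZMod 3) H.direction + 1 = n

/-- An `a`-line: a pair of points `{b, c}` such that `{a, b, c}` is a line. -/
def IsALine {n : ℕ} (a : AG n) (p : Finset (AG n)) : Prop :=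
  ∃ b c : AG n, p = {b, c} ∧ IsLine a b c

/-- A family of pairs of points is co-hyperplanar with respect to `a` if some hyperplane contains
`a` and all the pairs, that is, all the lines `{a, b, c}` with `{b, c}` in the family. -/
def CoHyperplanar {n : ℕ} (a : AG n) (Q : Finset (Finset (AG n))) : Prop :=
  ∃ H : AffineSubspace (ZMod 3) (AG n), IsHyperplane H ∧ a ∈ H ∧ ∀ p ∈ Q, ∀ x ∈ p, x ∈ H

/-- `D` is a demicap with anchor point `a`: a cap in `AG(4,3)` that is the union of five `a`-lines
no four of which are co-hyperplanar. -/
def IsDemicapWithAnchor (a : AG 4) (D : Finset (AG 4)) : Prop :=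
  IsCap D ∧ ∃ P : Finset (Finset (AG 4)),
    P.card = 5 ∧ (∀ p ∈ P, IsALine a p) ∧ D = P.biUnion id ∧
    ∀ Q ⊆ P, Q.card = 4 → ¬ CoHyperplanar a Q

/-- A demicap: a demicap with some anchor point. -/
def IsDemicap (D : Finset (AG 4)) : Prop :=
  ∃ a : AG 4, IsDemicapWithAnchor a D

/-! Call five vectors of sum zero, four of which form a basis, a frame. The demicaps with anchor `a`
are exactly the sets of points `a ± v i` for frames `v`. Indeed, if any four of five directions are
independent, their linear relation has no zero coefficient; each coefficient is `±1`, so scaling by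
it keeps the `a`-line and makes the sum zero (`IsDemicapWithAnchor.exists_frame`,
`IsFrame.isDemicapWithAnchor`). Frames correspond to ordered bases, and a demicap with given anchor
determines its frame up to order and a common sign, so each anchor has |GL(4,3)| / (5! · 2) =
24261120 / 240 = 101088 demicaps. Moreover, all demicaps are affinely equivalent to `lineUnion 0
stdFrame`.

The main point is that every cap with at least 20 points contains a demicap
(`IsCap.exists_lineUnion_subset`). A hyperplane meets a cap in at most 9 points, and a moment count
over all hyperplane directions gives a 20-point cap a parallel class with section sizes 9, 2, 9 or
9, 3, 8. After an affine normalization, an exhaustive search finds a demicap in every such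
configuration.

Another search, starting from the standard demicap, shows that a cap containing it has at most 20
points and that exactly six such caps have 20, all symmetric about 0. Hence maximal caps are the
20-point caps, every demicap lies in six of them, and every maximal cap is equivalent to one of the
six. In each of these only 0 can be an anchor, and its demicaps are given by five of the ten pairs
`±x` for which some choice of signs has sum zero; there are 72. -/

/-! ### Octal codes of points and search procedures -/

/-- The numbers below `8 ^ 4` all of whose octal digits are `0`, `3` or `6`, as a bit mask. -/
def zeroSumMask : ℕ :=
  (1 + 2 ^ 3 + 2 ^ 6) * (1 + 2 ^ 24 + 2 ^ 48) * (1 + 2 ^ 192 + 2 ^ 384) * (1 + 2 ^ 1536 + 2 ^ 3072)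

/-- Whether the bit `n` of `M` is zero. -/
def bitOff (M n : ℕ) : Bool := Nat.beq (Nat.land (Nat.shiftRight M n) 1) 0

/-- Whether `l` has at least `n` elements. -/
def atLeast (n : ℕ) (l : List ℕ) : Bool :=
  List.rec (motive := fun _ => ℕ → Bool) (fun n => Nat.beq n 0)
    (fun _ _ ih n => bif Nat.beq n 0 then true else ih (Nat.pred n)) l n

/-- The elements `x` of a list for which `{a, p, x}` is not a line for any `a` with mask in `M`. -/
def keep (M p : ℕ) (l : List ℕ) : List ℕ :=
  List.rec [] (fun x _ ih => Bool.rec ih (x :: ih) (bitOff M (Nat.add p x))) l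

/-- Exhaustive search for all ways to extend the cap `ch` by `need` points of `c`; the test `k` is
applied to each extension and to the points of `d` that are still free. -/
def capSearch (k : List ℕ → ℕ → List ℕ → Bool) (f : ℕ) :
    ℕ → List ℕ → ℕ → List ℕ → List ℕ → Bool :=
  Nat.rec (fun _ _ _ _ _ => false)
    (fun _ ih need ch M c d =>
      Nat.rec (k ch M d)
        (fun n _ => List.rec true (fun p c _ =>
          Bool.rec true
            (Bool.rec false (ih (Nat.succ n) ch M c d)
              (ih n (p :: ch) (Nat.lor M (Nat.shiftRight zeroSumMask p)) (keep M p c) (keep M p d)))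
            (atLeast n c)) c) need) f

/-- The mask of the sums `p + x` for which `p`, `x` and a point of the list add up to zero. -/
def blockMask : List ℕ → ℕ
  | [] => 0
  | a :: l => Nat.lor (blockMask l) (Nat.shiftRight zeroSumMask a)

/-- The elements of `L` that may be added to the cap `ch`. -/
def free (ch L : List ℕ) : List ℕ :=
  L.filter fun x => !ch.contains x &&
    ch.all fun p => ch.all fun a => Nat.beq a p || bitOff zeroSumMask (a + p + x)

/-- The codes of the points with first three coordinates arbitrary and last coordinate `0`. -/
def layer : List ℕ :=
  [0, 1, 2].flatMap fun i => [0, 8, 16].flatMap fun j => [0, 64, 128].map fun k => i + j + k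

/-- Reduction modulo `3` of each of four octal digits. -/
def mod3 (s : ℕ) : ℕ :=
  (s.mod 8).mod 3 + 8 * (((s.div 8).mod 8).mod 3) + 64 * (((s.div 64).mod 8).mod 3) +
    512 * (((s.div 512).mod 8).mod 3)

/-- Whether some `n`-element sublist of `l`, put in front of `acc`, passes the test `k`. -/
def anySublist (k : List ℕ → Bool) : List ℕ → ℕ → List ℕ → Bool :=
  List.rec (fun n acc => Nat.rec (k acc) (fun _ _ => false) n)
    (fun x _ ih n acc => Nat.rec (k acc)
      (fun n _ => Bool.rec (ih (n + 1) acc) true (ih n (x :: acc))) n)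

/-- Whether `x` is an element of `l`. -/
def memCode (x : ℕ) (l : List ℕ) : Bool :=
  List.rec false (fun y _ ih => Bool.rec ih true (Nat.beq x y)) l

/-- Whether the elements of `l` are distinct. -/
def nodupCode (l : List ℕ) : Bool :=
  List.rec true (fun y l ih => Bool.rec ih false (memCode y l)) l

/-- The sum of a list of codes, reduced modulo `3`. -/
def sumCode (l : List ℕ) : ℕ := List.rec 0 (fun x _ ih => mod3 (x + ih)) l

/-- Whether every element of `l` is an element of `l'`. -/
def subCode (l l' : List ℕ) : Bool :=
  List.rec true (fun y _ ih => Bool.rec false ih (memCode y l')) l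

/-- Whether the points `b`, `b'` and their reflections in `a` are distinct points of `ch`. -/
def isDemicapList (a : ℕ) (b ch : List ℕ) : Bool :=
  let l := b ++ b.map fun x => mod3 (2 * mod3 (a + x))
  subCode l ch && nodupCode l

/-- Whether `ch` contains five points with sum `-a` and their reflections in `a`, where
`a = -∑ x ∈ ch, x`. -/
def hasDemicap (ch : List ℕ) : Bool :=
  anySublist (fun b => isDemicapList (mod3 (2 * sumCode ch))
    (mod3 (2 * mod3 (mod3 (2 * sumCode ch) + sumCode b)) :: b) ch) ch 4 []

/-- The codes of the points with last coordinate `1`. -/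
def layer₁ : List ℕ := layer.map (512 + ·)

/-- The codes of the points with last coordinate `2`. -/
def layer₂ : List ℕ := layer.map (1024 + ·)

/-- The codes of all points. -/
def allCodes : List ℕ := layer ++ layer₁ ++ layer₂

/-- Whether all ways to extend `ch` by the point with code `512`, `m` more points in `layer₁` and
`n` points in `layer₂` contain a demicap. -/
def sectionTest (m n : ℕ) (ch : List ℕ) (M : ℕ) (_ : List ℕ) : Bool :=
  capSearch (fun ch M d => capSearch (fun ch _ _ => hasDemicap ch) 30 n ch M d [])
    30 m (512 :: ch) (Nat.lor M (Nat.shiftRight zeroSumMask 512)) (layer₁.erase 512)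
    (keep M 512 layer₂)

/-- The codes of the zero vector and the first three unit vectors. -/
def baseCodes : List ℕ := [0, 1, 8, 64]

/-- The codes of the unit vectors, of the negative of their sum, and of their negatives. -/
def stdCodes : List ℕ := [1, 8, 64, 512, 1170, 2, 16, 128, 1024, 585]

/-- The negative of a code. -/
def negCode (x : ℕ) : ℕ := mod3 (2 * x)

/-- Five codes together with `1, 8, 64, 512, 1170` represent the points up to sign of a cap that
contains `stdCodes`. -/
def capReps : List (List ℕ) :=
  [[74, 529, 594, 642, 648], [74, 530, 592, 641, 650], [81, 522, 594, 641, 656],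
    [81, 530, 578, 648, 657], [82, 522, 592, 642, 657], [82, 529, 578, 650, 656]].map
    ([1, 8, 64, 512, 1170] ++ ·)

/-- The list `l` followed by the negatives of its elements. -/
def withNeg (l : List ℕ) : List ℕ := l ++ l.map negCode

/-! ### Exhaustive searches -/

/-- Four base points and six more would be ten cap points in one hyperplane. The final test is
constantly false, so success means that no branch completes the six. Fuel 30 suffices for at most 27
candidates; running out of fuel would give `false`. -/
theorem capSearch_layer :
    capSearch (fun _ _ _ => false) 30 6 baseCodes (blockMask baseCodes) (free baseCodes layer) []
      = true := by decide +kernel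

/-- Section sizes 9, 2, 9: the base supplies four points of the first section and `512` one of the
second, which leaves 5, 1 and 9 to add. -/
theorem capSearch_sectionTest_one_nine :
    capSearch (sectionTest 1 9) 30 5 baseCodes (blockMask baseCodes) (free baseCodes layer) []
      = true := by decide +kernel

/-- Section sizes 9, 3, 8, with the same five points given. -/
theorem capSearch_sectionTest_two_eight :
    capSearch (sectionTest 2 8) 30 5 baseCodes (blockMask baseCodes) (free baseCodes layer) []
      = true := by decide +kernel

/-- Ten points added to the ten of the standard demicap: this classifies the 20-point caps above it.
-/
theorem capSearch_capReps :
    capSearch (fun ch _ _ => capReps.any fun l => subCode (withNeg l) ch) 40 10 stdCodes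
      (blockMask stdCodes) (free stdCodes allCodes) [] = true := by decide +kernel

/-! ### Soundness of the search -/

theorem bitOff_iff (M n : ℕ) : bitOff M n = true ↔ M.testBit n = false := by
  change Nat.beq (M >>> n &&& 1) 0 = true ↔ _
  rw [Nat.beq_eq, Nat.testBit, Nat.and_comm]
  simp

theorem testBit_blockMask (l : List ℕ) (s : ℕ) :
    (blockMask l).testBit s = true ↔ ∃ a ∈ l, zeroSumMask.testBit (a + s) = true := by
  induction l with
  | nil => simp [blockMask]
  | cons a l ih =>
    have h : blockMask (a :: l) = blockMask l ||| zeroSumMask >>> a := rfl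
    rw [h, Nat.testBit_or, Bool.or_eq_true, ih, Nat.testBit_shiftRight]
    simp [or_comm]

theorem keep_eq_filter (M p : ℕ) (l : List ℕ) :
    keep M p l = l.filter fun x => bitOff M (p + x) := by
  induction l with
  | nil => rfl
  | cons x l ih =>
    have h : keep M p (x :: l) = Bool.rec (keep M p l) (x :: keep M p l) (bitOff M (p + x)) := rfl
    rw [h, ih, List.filter_cons]
    cases bitOff M (p + x) <;> simp

theorem atLeast_iff (n : ℕ) (l : List ℕ) : atLeast n l = true ↔ n ≤ l.length := by
  induction l generalizing n with
  | nil =>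
    have h : atLeast n [] = Nat.beq n 0 := rfl
    simp [h]
  | cons a l ih =>
    have h : atLeast n (a :: l) = bif Nat.beq n 0 then true else atLeast (n - 1) l := rfl
    cases n with
    | zero => simp [h]
    | succ n => rw [h]; simpa [Nat.beq] using ih n

/-- A set of codes such that no two distinct elements sum with an element to zero. -/
def IsCodeCap (S : Finset ℕ) : Prop :=
  ∀ a ∈ S, ∀ p ∈ S, ∀ x ∈ S, a ≠ p → zeroSumMask.testBit (a + p + x) = false

/-- A discarded `x ∈ S` would complete `p` and some `a ∈ ch` to a zero sum with `a ≠ p`, which `S`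
excludes. So discarding candidates blocked by `p` loses no point of `S`. -/
theorem countP_keep {S : Finset ℕ} (hS : IsCodeCap S) {ch : List ℕ} (hch : ∀ x ∈ ch, x ∈ S)
    {p : ℕ} (hp : p ∈ S) (hpc : p ∉ ch) (l : List ℕ) :
    (keep (blockMask ch) p l).countP (· ∈ S) = l.countP (· ∈ S) := by
  rw [keep_eq_filter, List.countP_filter]
  refine List.countP_congr fun x _ => ?_
  simp only [Bool.and_eq_true, decide_eq_true_eq, and_iff_left_iff_imp]
  intro hx
  rw [bitOff_iff, Bool.eq_false_iff, Ne, testBit_blockMask]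
  rintro ⟨a, ha, h⟩
  rw [← add_assoc, hS a (hch a ha) p hp x hx (fun h => hpc (h ▸ ha))] at h
  simp at h

/-- Follow the branch that accepts a candidate exactly when it lies in `S`. There the number of
candidates in `S` always covers `need`, so the branch is not ended by an empty list or by the
`atLeast` cut-off, both of which report success vacuously. The spare list `d` is thinned along the
way so that a later search can continue in another layer. -/
theorem capSearch_spec {S : Finset ℕ} (hS : IsCodeCap S) {k : List ℕ → ℕ → List ℕ → Bool} (f : ℕ) :
    ∀ (need : ℕ) (ch : List ℕ) (M : ℕ) (c d : List ℕ), capSearch k f need ch M c d = true →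
      M = blockMask ch → (∀ x ∈ ch, x ∈ S) → c.Nodup → (∀ x ∈ c, x ∉ ch) →
      need ≤ c.countP (· ∈ S) →
      ∃ ch' d', k ch' (blockMask ch') d' = true ∧ (∀ x ∈ ch', x ∈ S) ∧
        (∀ x ∈ ch', x ∈ ch ∨ x ∈ c) ∧ d'.Sublist d ∧
        d'.countP (· ∈ S) = d.countP (· ∈ S) := by
  induction f with
  | zero =>
    intro need ch M c d h
    exact absurd h Bool.false_ne_true
  | succ f ih =>
    intro need ch M c d h hM hch hc hcd hn
    cases need with
    | zero => exact ⟨ch, d, hM ▸ h, hch, fun x hx => .inl hx, List.Sublist.refl d, rfl⟩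
    | succ n =>
      cases c with
      | nil => simp at hn
      | cons p c =>
        have e : capSearch k (f + 1) (n + 1) ch M (p :: c) d =
            Bool.rec (motive := fun _ => Bool) true
              (Bool.rec (motive := fun _ => Bool) false (capSearch k f (n + 1) ch M c d)
                (capSearch k f n (p :: ch) (Nat.lor M (Nat.shiftRight zeroSumMask p))
                  (keep M p c) (keep M p d)))
              (atLeast n c) := rfl
        have hl : atLeast n c = true := by
          rw [atLeast_iff]
          have := List.countP_le_length (p := fun x => decide (x ∈ S)) (l := p :: c)
          simp only [List.length_cons] at this
          omega
        have h : capSearch k f (n + 1) ch M c d = true ∧ capSearch k f n (p :: ch)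
            (Nat.lor M (Nat.shiftRight zeroSumMask p)) (keep M p c) (keep M p d) = true := by
          rw [e, hl] at h
          revert h
          cases capSearch k f n (p :: ch) (Nat.lor M (Nat.shiftRight zeroSumMask p))
            (keep M p c) (keep M p d) <;> simp
        rw [List.nodup_cons] at hc
        by_cases hp : p ∈ S
        · have hpc : p ∉ ch := hcd p (by simp)
          have hk : ∀ l, (keep M p l).Sublist l := fun l => by
            rw [keep_eq_filter]; exact List.filter_sublist
          obtain ⟨ch', d', h1, h2, h3, h4, h5⟩ := ih n (p :: ch) _ (keep M p c) (keep M p d) h.2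
            (by rw [hM]; rfl) (by simpa [hp] using hch) (hc.2.sublist (hk c))
            (by
              intro x hx
              have hx := (hk c).subset hx
              have := hcd x (by simp [hx])
              simp only [List.mem_cons, not_or]
              exact ⟨fun e => hc.1 (e ▸ hx), this⟩)
            (by
              rw [hM, countP_keep hS hch hp hpc]
              rw [List.countP_cons_of_pos (by simpa using hp)] at hn
              omega)
          refine ⟨ch', d', h1, h2, fun x hx => ?_, h4.trans (hk d), ?_⟩
          · rcases h3 x hx with h | h
            · rcases List.mem_cons.1 h with rfl | h <;> simp [*]
            · exact .inr (by simp [(hk c).subset h])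
          · rw [h5, hM, countP_keep hS hch hp hpc]
        · obtain ⟨ch', d', h1, h2, h3, h4⟩ := ih (n + 1) ch M c d h.1 hM hch hc.2
            (fun x hx => hcd x (by simp [hx]))
            (by rwa [List.countP_cons_of_neg (by simpa using hp)] at hn)
          exact ⟨ch', d', h1, h2, fun x hx => (h3 x hx).imp_right fun h => by simp [h], h4⟩

theorem List.countP_le_add_countP {α : Type*} {p q r : α → Bool} (l : List α)
    (h : ∀ x, p x → q x ∨ r x) : l.countP p ≤ l.countP q + l.countP r := by
  induction l with
  | nil => simp
  | cons x l ih =>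
    have := h x
    rw [countP_cons, countP_cons, countP_cons]
    split_ifs <;> simp_all <;> omega

/-- The cap property keeps every point of `S` outside `ch` free; at most `ch.length` points of `L`
lie in `ch`. -/
theorem countP_le_free {S : Finset ℕ} (hS : IsCodeCap S) {ch : List ℕ} (hch : ∀ x ∈ ch, x ∈ S)
    {L : List ℕ} (hL : L.Nodup) :
    L.countP (· ∈ S) ≤ (free ch L).countP (· ∈ S) + ch.length := by
  have h1 : L.countP (· ∈ ch) ≤ ch.length := by
    rw [List.countP_eq_length_filter]
    refine ((hL.filter _).subperm fun x hx => ?_).length_le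
    simpa using (List.mem_filter.1 hx).2
  refine le_trans ?_ (Nat.add_le_add_left h1 _)
  rw [free, List.countP_filter]
  refine List.countP_le_add_countP L fun x hx => ?_
  have hx : x ∈ S := by simpa using hx
  by_cases hxc : x ∈ ch
  · exact .inr (by simpa using hxc)
  · left
    simp only [hx, hxc, decide_true, Bool.true_and, List.contains_eq_mem, decide_false,
      Bool.not_false, List.all_eq_true, Bool.or_eq_true, Nat.beq_eq]
    intro p hp a ha
    by_cases h : a = p
    · exact .inl h
    · exact .inr ((bitOff_iff _ _).2 (hS a (hch a ha) p (hch p hp) x hx h))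

/-! ### Codes and points of AG(4,3) -/

/-- The vector `x` read as an octal number with digits `0`, `1`, `2`. -/
def code (x : AG 4) : ℕ := (x 0).val + 8 * (x 1).val + 64 * (x 2).val + 512 * (x 3).val

theorem octal_digits {a b c d : ℕ} (ha : a < 8) (hb : b < 8) (hc : c < 8) (hd : d < 8) :
    (a + 8 * b + 64 * c + 512 * d) % 8 = a ∧ (a + 8 * b + 64 * c + 512 * d) / 8 % 8 = b ∧
      (a + 8 * b + 64 * c + 512 * d) / 64 % 8 = c ∧
      (a + 8 * b + 64 * c + 512 * d) / 512 % 8 = d := by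
  refine ⟨?_, ?_, ?_, ?_⟩ <;> omega

theorem mod3_eq {a b c d : ℕ} (ha : a < 8) (hb : b < 8) (hc : c < 8) (hd : d < 8) :
    mod3 (a + 8 * b + 64 * c + 512 * d) = a % 3 + 8 * (b % 3) + 64 * (c % 3) + 512 * (d % 3) := by
  obtain ⟨h0, h1, h2, h3⟩ := octal_digits ha hb hc hd
  generalize a + 8 * b + 64 * c + 512 * d = s at *
  change s % 8 % 3 + 8 * (s / 8 % 8 % 3) + 64 * (s / 64 % 8 % 3) + 512 * (s / 512 % 8 % 3) = _
  rw [h0, h1, h2, h3]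

theorem code_injective : Function.Injective code := by
  intro x y h
  have hx := fun i => (ZMod.val_lt (x i)).trans (show 3 < 8 by norm_num)
  have hy := fun i => (ZMod.val_lt (y i)).trans (show 3 < 8 by norm_num)
  obtain ⟨h0, h1, h2, h3⟩ := octal_digits (hx 0) (hx 1) (hx 2) (hx 3)
  obtain ⟨k0, k1, k2, k3⟩ := octal_digits (hy 0) (hy 1) (hy 2) (hy 3)
  unfold code at h
  rw [h] at h0 h1 h2 h3
  funext i
  apply ZMod.val_injective
  fin_cases i
  exacts [h0.symm.trans k0, h1.symm.trans k1, h2.symm.trans k2, h3.symm.trans k3]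

theorem mod3_code_add (x y : AG 4) : mod3 (code x + code y) = code (x + y) := by
  have h := fun i => show (x i).val + (y i).val < 8 from by
    have := ZMod.val_lt (x i); have := ZMod.val_lt (y i); omega
  simp only [code, Pi.add_apply, ZMod.val_add]
  rw [← mod3_eq (h 0) (h 1) (h 2) (h 3)]
  congr 1
  ring

theorem neg_eq_add_self (x : AG 4) : -x = x + x := by
  funext i
  have : ∀ t : ZMod 3, -t = t + t := by decide
  exact this _

theorem mod3_two_mul_code (x : AG 4) : mod3 (2 * code x) = code (-x) := by
  rw [two_mul, mod3_code_add, neg_eq_add_self]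

theorem negCode_code (x : AG 4) : negCode (code x) = code (-x) := mod3_two_mul_code x

theorem digits_of_testBit_zeroSumMask :
    ∀ i < 64, ∀ j < 64, zeroSumMask.testBit (64 * i + j) = true →
      (64 * i + j) % 8 % 3 = 0 ∧ (64 * i + j) / 8 % 8 % 3 = 0 ∧ (64 * i + j) / 64 % 8 % 3 = 0 ∧
        (64 * i + j) / 512 % 8 % 3 = 0 := by
  decide +kernel

/-- The digits of a sum of three codes are at most 6, so octal addition does not carry and the mask
tests each coordinate modulo 3 separately. -/
theorem add_eq_zero_of_testBit {x y z : AG 4}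
    (h : zeroSumMask.testBit (code x + code y + code z) = true) : x + y + z = 0 := by
  have hlt := fun i => show (x i).val + (y i).val + (z i).val < 8 from by
    have := ZMod.val_lt (x i); have := ZMod.val_lt (y i); have := ZMod.val_lt (z i); omega
  obtain ⟨k0, k1, k2, k3⟩ := octal_digits (hlt 0) (hlt 1) (hlt 2) (hlt 3)
  have e : code x + code y + code z = ((x 0).val + (y 0).val + (z 0).val) +
      8 * ((x 1).val + (y 1).val + (z 1).val) + 64 * ((x 2).val + (y 2).val + (z 2).val) +
      512 * ((x 3).val + (y 3).val + (z 3).val) := by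
    unfold code; ring
  rw [e] at h
  generalize hs : ((x 0).val + (y 0).val + (z 0).val) +
      8 * ((x 1).val + (y 1).val + (z 1).val) + 64 * ((x 2).val + (y 2).val + (z 2).val) +
      512 * ((x 3).val + (y 3).val + (z 3).val) = s at *
  have hs' : s < 64 * 64 := by have := hlt 0; have := hlt 1; have := hlt 2; have := hlt 3; omega
  have := digits_of_testBit_zeroSumMask (s / 64) (Nat.div_lt_of_lt_mul hs') (s % 64)
    (Nat.mod_lt _ (by norm_num))
  rw [Nat.div_add_mod] at this
  obtain ⟨h0, h1, h2, h3⟩ := this h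
  rw [k0] at h0
  rw [k1] at h1
  rw [k2] at h2
  rw [k3] at h3
  funext i
  apply ZMod.val_injective
  simp only [Pi.add_apply, ZMod.val_add, Pi.zero_apply, ZMod.val_zero, Nat.mod_add_mod]
  fin_cases i
  exacts [h0, h1, h2, h3]

theorem eq_of_add_self_add {x y : AG 4} (h : x + x + y = 0) : y = x := by
  rw [← neg_eq_add_self] at h
  exact (neg_add_eq_zero.1 h).symm

/-- In characteristic 3, three vectors with sum zero are all equal or all distinct, and the latter
form a line. -/
theorem IsCap.eq_of_add_eq_zero {C : Finset (AG 4)} (hC : IsCap C) {x y z : AG 4} (hx : x ∈ C)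
    (hy : y ∈ C) (hz : z ∈ C) (h : x + y + z = 0) : x = y := by
  by_contra hxy
  have h' : z + x + y = 0 := by rw [← h]; abel
  have h'' : y + z + x = 0 := by rw [← h]; abel
  refine hC x hx y hy z hz ⟨hxy, ?_, ?_, h⟩
  · rintro rfl; exact hxy (eq_of_add_self_add h').symm
  · rintro rfl; exact hxy (eq_of_add_self_add h'')

theorem IsCap.isCodeCap {C : Finset (AG 4)} (hC : IsCap C) : IsCodeCap (C.image code) := by
  intro a ha p hp x hx hap
  obtain ⟨a, ha', rfl⟩ := Finset.mem_image.1 ha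
  obtain ⟨p, hp', rfl⟩ := Finset.mem_image.1 hp
  obtain ⟨x, hx', rfl⟩ := Finset.mem_image.1 hx
  rw [Bool.eq_false_iff]
  exact fun h => hap (congrArg code (hC.eq_of_add_eq_zero ha' hp' hx' (add_eq_zero_of_testBit h)))

theorem code_mem_image {C : Finset (AG 4)} {x : AG 4} : code x ∈ C.image code ↔ x ∈ C := by
  simp [code_injective.eq_iff]

theorem code_mem_layer {x : AG 4} (hx : x 3 = 0) : code x ∈ layer := by
  have : ∀ t : ZMod 3, t.val ∈ [0, 1, 2] ∧ 8 * t.val ∈ [0, 8, 16] ∧ 64 * t.val ∈ [0, 64, 128] := by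
    decide
  unfold layer code
  rw [hx]
  exact List.mem_flatMap.2 ⟨_, (this (x 0)).1, List.mem_flatMap.2 ⟨_, (this (x 1)).2.1,
    List.mem_map.2 ⟨_, (this (x 2)).2.2, by simp⟩⟩⟩

theorem code_sub_mem_layer (x : AG 4) :
    (x 0).val + 8 * (x 1).val + 64 * (x 2).val ∈ layer := by
  have := code_mem_layer (x := ![x 0, x 1, x 2, 0]) rfl
  simpa [code] using this

theorem code_mem_layer₁ {x : AG 4} (hx : x 3 = 1) : code x ∈ layer₁ :=
  List.mem_map.2 ⟨_, code_sub_mem_layer x, by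
    have : (x 3).val = 1 := by rw [hx]; rfl
    unfold code; omega⟩

theorem code_mem_layer₂ {x : AG 4} (hx : x 3 = 2) : code x ∈ layer₂ :=
  List.mem_map.2 ⟨_, code_sub_mem_layer x, by
    have : (x 3).val = 2 := by rw [hx]; rfl
    unfold code; omega⟩

theorem code_mem_allCodes (x : AG 4) : code x ∈ allCodes := by
  have : ∀ t : ZMod 3, t = 0 ∨ t = 1 ∨ t = 2 := by decide
  unfold allCodes
  rw [List.mem_append, List.mem_append]
  rcases this (x 3) with h | h | h
  · exact .inl (.inl (code_mem_layer h))
  · exact .inl (.inr (code_mem_layer₁ h))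
  · exact .inr (code_mem_layer₂ h)

theorem card_le_countP {C D : Finset (AG 4)} {L : List ℕ} (hD : D ⊆ C)
    (hL : ∀ x ∈ D, code x ∈ L) : D.card ≤ L.countP (· ∈ C.image code) := by
  rw [← Finset.card_image_of_injective D code_injective, List.countP_eq_length_filter]
  refine le_trans (Finset.card_le_card ?_) (List.toFinset_card_le _)
  intro n hn
  obtain ⟨x, hx, rfl⟩ := Finset.mem_image.1 hn
  rw [List.mem_toFinset, List.mem_filter]
  exact ⟨hL x hx, by simpa using ⟨x, hD hx, rfl⟩⟩

/-! ### Recognizing a demicap among codes -/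

theorem memCode_iff {x : ℕ} {l : List ℕ} : memCode x l = true ↔ x ∈ l := by
  induction l with
  | nil => exact ⟨fun h => absurd h Bool.false_ne_true, fun h => absurd h List.not_mem_nil⟩
  | cons y l ih =>
    have h : memCode x (y :: l) = (Nat.beq x y || memCode x l) := by
      change Bool.rec (motive := fun _ => Bool) _ _ _ = _
      cases Nat.beq x y <;> rfl
    rw [h, Bool.or_eq_true, ih, Nat.beq_eq, List.mem_cons]

theorem nodupCode_iff {l : List ℕ} : nodupCode l = true ↔ l.Nodup := by
  induction l with
  | nil => exact ⟨fun _ => List.nodup_nil, fun _ => rfl⟩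
  | cons y l ih =>
    have h : nodupCode (y :: l) = (!memCode y l && nodupCode l) := by
      change Bool.rec (motive := fun _ => Bool) _ _ _ = _
      cases memCode y l <;> rfl
    rw [h, Bool.and_eq_true, ih, List.nodup_cons, ← memCode_iff (x := y)]
    simp

theorem subCode_iff {l l' : List ℕ} : subCode l l' = true ↔ ∀ x ∈ l, x ∈ l' := by
  induction l with
  | nil => exact ⟨fun _ x h => absurd h List.not_mem_nil, fun _ => rfl⟩
  | cons y l ih =>
    have h : subCode (y :: l) l' = (memCode y l' && subCode l l') := by
      change Bool.rec (motive := fun _ => Bool) _ _ _ = _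
      cases memCode y l' <;> rfl
    rw [h, Bool.and_eq_true, ih, memCode_iff]
    simp

theorem sumCode_map_code (l : List (AG 4)) : sumCode (l.map code) = code l.sum := by
  induction l with
  | nil => rfl
  | cons x l ih =>
    have h : sumCode ((x :: l).map code) = mod3 (code x + sumCode (l.map code)) := rfl
    rw [h, ih, mod3_code_add, List.sum_cons]

theorem exists_of_anySublist {k : List ℕ → Bool} {l : List ℕ} {n : ℕ} {acc : List ℕ}
    (h : anySublist k l n acc = true) :
    ∃ b, k b = true ∧ b.length = n + acc.length ∧ ∀ x ∈ b, x ∈ l ∨ x ∈ acc := by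
  induction l generalizing n acc with
  | nil =>
    cases n with
    | zero => exact ⟨acc, h, by simp, fun x hx => .inr hx⟩
    | succ n => exact absurd h Bool.false_ne_true
  | cons x l ih =>
    cases n with
    | zero => exact ⟨acc, h, by simp, fun x hx => .inr hx⟩
    | succ n =>
      have e : anySublist k (x :: l) (n + 1) acc =
          (anySublist k l n (x :: acc) || anySublist k l (n + 1) acc) := by
        change Bool.rec (motive := fun _ => Bool) (anySublist k l (n + 1) acc) true
          (anySublist k l n (x :: acc)) = _
        cases anySublist k l n (x :: acc) <;> rfl
      rw [e, Bool.or_eq_true] at h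
      rcases h with h | h
      · obtain ⟨b, h1, h2, h3⟩ := ih h
        refine ⟨b, h1, by simp at h2; omega, fun y hy => ?_⟩
        rcases h3 y hy with h | h
        · simp [h]
        · rcases List.mem_cons.1 h with rfl | h <;> simp [*]
      · obtain ⟨b, h1, h2, h3⟩ := ih h
        exact ⟨b, h1, h2, fun y hy => (h3 y hy).imp_left fun h => by simp [h]⟩

theorem exists_map_code {C : Finset (AG 4)} {l : List ℕ} (h : ∀ x ∈ l, x ∈ C.image code) :
    ∃ l' : List (AG 4), l'.map code = l ∧ ∀ x ∈ l', x ∈ C := by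
  induction l with
  | nil => exact ⟨[], rfl, by simp⟩
  | cons n l ih =>
    obtain ⟨l', rfl, hl⟩ := ih fun x hx => h x (by simp [hx])
    obtain ⟨x, hx, rfl⟩ := Finset.mem_image.1 (h n (by simp))
    exact ⟨x :: l', rfl, by simpa [hx] using hl⟩

/-- The guess `a = -∑ x` for the anchor is right for ten pairs `x`, `-(a + x)`: their total is `-10a
= -a`. Five points `a + v i` with `∑ v i = 0` have sum `5a = -a`, so four of them determine the
fifth. Only soundness of the test is needed. -/
theorem exists_of_hasDemicap {C : Finset (AG 4)} {ch : List ℕ} (hch : ∀ x ∈ ch, x ∈ C.image code)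
    (h : hasDemicap ch = true) :
    ∃ (a : AG 4) (l : List (AG 4)), l.length = 5 ∧ l.sum = -a ∧
      (l ++ l.map fun x => -(a + x)).Nodup ∧ ∀ x ∈ l ++ l.map fun x => -(a + x), x ∈ C := by
  obtain ⟨ch, rfl, hC⟩ := exists_map_code hch
  obtain ⟨b, h1, h2, h3⟩ := exists_of_anySublist h
  obtain ⟨b, rfl, hb⟩ := exists_map_code (C := C) (l := b) fun x hx =>
    hch x ((h3 x hx).resolve_right List.not_mem_nil)
  rw [sumCode_map_code, sumCode_map_code, mod3_two_mul_code, mod3_code_add, mod3_two_mul_code] at h1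
  set a := -ch.sum
  have e : (code (-(a + b.sum)) :: b.map code) ++ (code (-(a + b.sum)) :: b.map code).map
      (fun x => mod3 (2 * mod3 (code a + x))) =
      (((-(a + b.sum)) :: b) ++ ((-(a + b.sum)) :: b).map fun x => -(a + x)).map code := by
    rw [← List.map_cons, List.map_append, List.map_map, List.map_map]
    congr 1
    refine List.map_congr_left fun x _ => ?_
    simp only [Function.comp_apply, mod3_code_add, mod3_two_mul_code]
  simp only [isDemicapList, Bool.and_eq_true, e, subCode_iff, nodupCode_iff] at h1
  refine ⟨a, (-(a + b.sum)) :: b, by simpa using h2, by simp, h1.2.of_map, fun x hx => ?_⟩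
  exact code_mem_image.1 (hch _ (h1.1 _ (List.mem_map_of_mem hx)))

/-! ### Frames and demicaps -/

/-- The points `a ± v i`. -/
def lineUnion (a : AG 4) (v : Fin 5 → AG 4) : Finset (AG 4) :=
  ((Finset.univ : Finset (Fin 5 × ZMod 3)).filter fun s => s.2 ≠ 0).image
    fun s => a + s.2 • v s.1

theorem mem_lineUnion {a : AG 4} {v : Fin 5 → AG 4} {x : AG 4} :
    x ∈ lineUnion a v ↔ ∃ (i : Fin 5) (s : ZMod 3), s ≠ 0 ∧ x = a + s • v i := by
  simp [lineUnion, eq_comm]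

/-- Five vectors with sum zero, four of which form a basis. -/
def IsFrame (v : Fin 5 → AG 4) : Prop :=
  LinearIndependent (ZMod 3) (fun i : Fin 4 => v i.castSucc) ∧ ∑ i, v i = 0

/-- Subtracting `g (Fin.last 4)` times `∑ v i = 0` leaves a relation among four basis vectors. So
the relations of a frame are exactly the constant ones. -/
theorem IsFrame.eq_last {v : Fin 5 → AG 4} (hv : IsFrame v) {g : Fin 5 → ZMod 3}
    (hg : ∑ i, g i • v i = 0) (i : Fin 5) : g i = g (Fin.last 4) := by
  have h : ∑ i, (g i - g (Fin.last 4)) • v i = 0 := by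
    simp_rw [sub_smul, Finset.sum_sub_distrib, hg, ← Finset.smul_sum, hv.2, smul_zero, sub_zero]
  rw [Fin.sum_univ_castSucc, sub_self, zero_smul, add_zero] at h
  have := Fintype.linearIndependent_iff.1 hv.1 _ h
  induction i using Fin.lastCases with
  | last => rfl
  | cast i => exact sub_eq_zero.1 (this i)

theorem add_three_eq (a x y z : AG 4) : (a + x) + (a + y) + (a + z) = x + y + z := by
  have h : a + a + a = 0 := by rw [← neg_eq_add_self, neg_add_cancel]
  calc _ = (a + a + a) + (x + y + z) := by abel
    _ = _ := by rw [h, zero_add]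

/-- At most three of five indices carry a coefficient, so a constant function would be zero;
distinct signed indices exclude that. -/
theorem exists_single_ne : ∀ (i j k : Fin 5) (s t w : ZMod 3), s ≠ 0 → t ≠ 0 → w ≠ 0 →
    (i, s) ≠ (j, t) → (i, s) ≠ (k, w) → (j, t) ≠ (k, w) →
    ∃ l, (if l = i then s else 0) + (if l = j then t else 0) + (if l = k then w else 0) ≠
      (if Fin.last 4 = i then s else 0) + (if Fin.last 4 = j then t else 0) +
        (if Fin.last 4 = k then w else 0) := by
  decide +kernel

theorem exists_single_ne_two : ∀ (i j : Fin 5) (s t : ZMod 3), s ≠ 0 → t ≠ 0 → (i, s) ≠ (j, t) →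
    ∃ l, (if l = i then s else 0) - (if l = j then t else 0) ≠
      (if Fin.last 4 = i then s else 0) - (if Fin.last 4 = j then t else 0) := by
  decide +kernel

theorem IsFrame.injective {v : Fin 5 → AG 4} (hv : IsFrame v) {i j : Fin 5} {s t : ZMod 3}
    (hs : s ≠ 0) (ht : t ≠ 0) (h : s • v i = t • v j) : (i, s) = (j, t) := by
  by_contra hne
  obtain ⟨l, hl⟩ := exists_single_ne_two i j s t hs ht hne
  exact hl (hv.eq_last (g := fun l => (if l = i then s else 0) - (if l = j then t else 0))
    (by simp [sub_smul, Finset.sum_sub_distrib, ite_smul, h]) l)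

theorem IsFrame.isCap_lineUnion {v : Fin 5 → AG 4} (hv : IsFrame v) (a : AG 4) :
    IsCap (lineUnion a v) := by
  rintro x hx y hy z hz ⟨hxy, hxz, hyz, h⟩
  obtain ⟨i, s, hs, rfl⟩ := mem_lineUnion.1 hx
  obtain ⟨j, t, ht, rfl⟩ := mem_lineUnion.1 hy
  obtain ⟨k, w, hw, rfl⟩ := mem_lineUnion.1 hz
  rw [add_three_eq] at h
  obtain ⟨l, hl⟩ := exists_single_ne i j k s t w hs ht hw
    (by rintro ⟨⟩; exact hxy rfl) (by rintro ⟨⟩; exact hxz rfl) (by rintro ⟨⟩; exact hyz rfl)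
  exact hl (hv.eq_last (g := fun l => (if l = i then s else 0) + (if l = j then t else 0) +
    (if l = k then w else 0)) (by simp [add_smul, Finset.sum_add_distrib, ite_smul, h]) l)

theorem IsFrame.card_lineUnion {v : Fin 5 → AG 4} (hv : IsFrame v) (a : AG 4) :
    (lineUnion a v).card = 10 := by
  rw [lineUnion, Finset.card_image_of_injOn]
  · decide
  · rintro ⟨i, s⟩ hs ⟨j, t⟩ ht h
    exact hv.injective (by simpa using hs) (by simpa using ht) (add_left_cancel h)

theorem isALine_pair {a u : AG 4} (hu : u ≠ 0) : IsALine a {a + u, a - u} := by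
  refine ⟨a + u, a - u, rfl, by simpa using hu, fun h => hu (sub_eq_self.1 h.symm), ?_, ?_⟩
  · intro h
    have h : u + u + 0 = 0 := by
      rw [sub_eq_add_neg] at h
      have h := add_left_cancel h
      rw [add_zero, eq_neg_iff_add_eq_zero.1 h]
    exact hu (eq_of_add_self_add h).symm
  · have := add_three_eq a 0 u (-u)
    simpa [sub_eq_add_neg] using this

theorem eq_zero_or_one_or (s : ZMod 3) : s = 0 ∨ s = 1 ∨ s = -1 := by
  revert s; decide

theorem mem_pair {a u x : AG 4} :
    x ∈ ({a + u, a - u} : Finset (AG 4)) ↔ ∃ s : ZMod 3, s ≠ 0 ∧ x = a + s • u := by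
  rw [Finset.mem_insert, Finset.mem_singleton]
  constructor
  · rintro (rfl | rfl)
    · exact ⟨1, by decide, by simp⟩
    · exact ⟨-1, by decide, by simp [sub_eq_add_neg]⟩
  · rintro ⟨s, hs, rfl⟩
    rcases eq_zero_or_one_or s with rfl | rfl | rfl
    · exact absurd rfl hs
    · exact .inl (by simp)
    · exact .inr (by simp [sub_eq_add_neg])

theorem IsFrame.isDemicapWithAnchor {v : Fin 5 → AG 4} (hv : IsFrame v) (a : AG 4) :
    IsDemicapWithAnchor a (lineUnion a v) := by
  have hinj : Function.Injective fun i => ({a + v i, a - v i} : Finset (AG 4)) := by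
    intro i j h
    have : a + v i ∈ ({a + v j, a - v j} : Finset (AG 4)) := by
      rw [← show ({a + v i, a - v i} : Finset (AG 4)) = {a + v j, a - v j} from h]; simp
    obtain ⟨s, hs, h⟩ := mem_pair.1 this
    exact congrArg Prod.fst (hv.injective (s := 1) (by decide) hs (by simpa using h))
  have hne : ∀ i, v i ≠ 0 := fun i h => absurd (show (1 : ZMod 3) = -1 from
    congrArg Prod.snd (hv.injective (i := i) (j := i) (s := 1) (t := -1) (by decide) (by decide)
      (by simp [h]))) (by decide)
  refine ⟨hv.isCap_lineUnion a, Finset.univ.image fun i => {a + v i, a - v i}, ?_, ?_, ?_, ?_⟩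
  · rw [Finset.card_image_of_injective _ hinj]; rfl
  · intro p hp
    obtain ⟨i, -, rfl⟩ := Finset.mem_image.1 hp
    exact isALine_pair (hne i)
  · ext x
    simp only [mem_lineUnion, Finset.mem_biUnion, Finset.mem_image, Finset.mem_univ, true_and, id,
      exists_exists_eq_and, mem_pair]
  · rintro Q hQ hQ4 ⟨H, ⟨-, hH⟩, ha, hQH⟩
    have hlt : Q ⊂ Finset.univ.image fun i => ({a + v i, a - v i} : Finset (AG 4)) := by
      refine hQ.ssubset_of_ne ?_
      rintro rfl
      rw [Finset.card_image_of_injective _ hinj] at hQ4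
      simp at hQ4
    obtain ⟨p, hp, hpQ⟩ := Finset.exists_of_ssubset hlt
    obtain ⟨j, -, rfl⟩ := Finset.mem_image.1 hp
    have hQ' : Q = (Finset.univ.image fun i => ({a + v i, a - v i} : Finset (AG 4))).erase
        {a + v j, a - v j} := by
      refine Finset.eq_of_subset_of_card_le
        (fun q hq => Finset.mem_erase.2 ⟨fun h => hpQ (h ▸ hq), hQ hq⟩) ?_
      rw [Finset.card_erase_of_mem hp, Finset.card_image_of_injective _ hinj, hQ4]
      simp
    have hi : ∀ i, i ≠ j → v i ∈ H.direction := by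
      intro i hij
      have : a + v i ∈ H := hQH {a + v i, a - v i} (by
        rw [hQ', Finset.mem_erase]
        exact ⟨fun h => hij (hinj h), by simp⟩) _ (by simp)
      have := AffineSubspace.vsub_mem_direction this ha
      simpa using this
    -- The zero sum puts the fifth vector in the direction of `H` as well, which is then the whole
    -- space.
    have hj : v j ∈ H.direction := by
      have := hv.2
      rw [← Finset.add_sum_erase _ _ (Finset.mem_univ j)] at this
      rw [eq_neg_of_add_eq_zero_left this]
      exact neg_mem (sum_mem fun i hi' => hi i (Finset.ne_of_mem_erase hi'))
    have htop : (⊤ : Submodule (ZMod 3) (AG 4)) ≤ H.direction := by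
      rw [← hv.1.span_eq_top_of_card_eq_finrank' (by simp), Submodule.span_le]
      rintro _ ⟨i, rfl⟩
      by_cases h : i.castSucc = j
      · rw [← h] at hj
        exact hj
      · exact hi _ h
    rw [top_le_iff.1 htop, finrank_top, Module.finrank_fin_fun] at hH
    omega

theorem IsDemicapWithAnchor.exists_frame {a : AG 4} {D : Finset (AG 4)}
    (hD : IsDemicapWithAnchor a D) : ∃ v, IsFrame v ∧ D = lineUnion a v := by
  obtain ⟨-, P, hP5, hP, rfl, hQ⟩ := hD
  let e := P.equivFinOfCardEq hP5
  have : ∀ i, ∃ u : AG 4, ((e.symm i : P) : Finset (AG 4)) = {a + u, a - u} := by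
    intro i
    obtain ⟨b, c, h, -, -, -, h0⟩ := hP _ (e.symm i).2
    refine ⟨b - a, h.trans ?_⟩
    have : c = a - (b - a) := by
      have h1 : a + a + a = 0 := by rw [← neg_eq_add_self, neg_add_cancel]
      calc c = (a + b + c) - a - b := by abel
        _ = (a + a + a) - a - b := by rw [h0, h1]
        _ = _ := by abel
    rw [add_sub_cancel, this]
  choose u hu using this
  -- Four dependent directions lie in the kernel of a nonzero functional, whose translate through
  -- `a` is a hyperplane containing four of the lines.
  have hli : ∀ j : Fin 5, LinearIndependent (ZMod 3) (u ∘ j.succAbove) := by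
    intro j
    by_contra hdep
    have hlt : Submodule.span (ZMod 3) (Set.range (u ∘ j.succAbove)) < ⊤ := by
      rw [lt_top_iff_ne_top]
      intro h
      exact hdep (linearIndependent_of_top_le_span_of_card_eq_finrank h.ge (by simp))
    obtain ⟨f, hf, hle⟩ := Submodule.exists_le_ker_of_lt_top _ hlt
    refine hQ (Finset.univ.image fun k => ((e.symm (j.succAbove k) : P) : Finset (AG 4))) ?_ ?_ ?_
    · intro p hp
      obtain ⟨k, -, rfl⟩ := Finset.mem_image.1 hp
      exact (e.symm _).2
    · rw [Finset.card_image_of_injective]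
      · simp
      · exact Subtype.val_injective.comp (e.symm.injective.comp Fin.succAbove_right_injective)
    · refine ⟨AffineSubspace.mk' a (LinearMap.ker f), ⟨⟨a, AffineSubspace.self_mem_mk' _ _⟩, ?_⟩,
        AffineSubspace.self_mem_mk' _ _, ?_⟩
      · rw [AffineSubspace.direction_mk', Module.Dual.finrank_ker_add_one_of_ne_zero hf]
        simp
      · intro p hp x hx
        obtain ⟨k, -, rfl⟩ := Finset.mem_image.1 hp
        rw [hu, mem_pair] at hx
        obtain ⟨s, -, rfl⟩ := hx
        rw [AffineSubspace.mem_mk', vsub_eq_sub, add_sub_cancel_left]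
        exact Submodule.smul_mem _ _ (hle (Submodule.subset_span ⟨k, rfl⟩))
  have hdep : ¬ LinearIndependent (ZMod 3) u := fun h => by
    have := h.fintype_card_le_finrank
    simp at this
  obtain ⟨r, hr, i₀, hi₀⟩ := Fintype.not_linearIndependent_iff.1 hdep
  -- A zero coefficient would leave a relation among four independent vectors.
  have hr0 : ∀ j, r j ≠ 0 := by
    intro j hj
    rw [Fin.sum_univ_succAbove _ j, hj, zero_smul, zero_add] at hr
    have := Fintype.linearIndependent_iff.1 (hli j) _ hr
    rcases Fin.eq_self_or_eq_succAbove j i₀ with rfl | ⟨k, rfl⟩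
    · exact hi₀ hj
    · exact hi₀ (this k)
  refine ⟨fun i => r i • u i, ⟨?_, hr⟩, ?_⟩
  · rw [Fintype.linearIndependent_iff]
    intro g hg i
    have h := Fintype.linearIndependent_iff.1 (hli (Fin.last 4)) (fun i => g i * r i.castSucc)
      (by simpa only [mul_smul, Function.comp_apply, Fin.succAbove_last] using hg) i
    exact (mul_eq_zero.1 h).resolve_right (hr0 _)
  · ext x
    simp only [Finset.mem_biUnion, mem_lineUnion, id]
    constructor
    · rintro ⟨p, hp, hx⟩
      have hpe : p = {a + u (e ⟨p, hp⟩), a - u (e ⟨p, hp⟩)} := by rw [← hu]; simp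
      rw [hpe, mem_pair] at hx
      obtain ⟨s, hs, rfl⟩ := hx
      refine ⟨e ⟨p, hp⟩, s * r (e ⟨p, hp⟩), mul_ne_zero hs (hr0 _), ?_⟩
      have h1 : ∀ t : ZMod 3, t ≠ 0 → t * t = 1 := by decide
      rw [smul_smul, mul_assoc, h1 _ (hr0 _), mul_one]
    · rintro ⟨i, s, hs, rfl⟩
      refine ⟨_, (e.symm i).2, ?_⟩
      rw [hu, mem_pair]
      exact ⟨s * r i, mul_ne_zero hs (hr0 _), by rw [smul_smul]⟩

theorem exists_three_of_fin_five : ∀ h : Fin 5 → ZMod 3, ∃ c, ∃ i j k : Fin 5,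
    i ≠ j ∧ i ≠ k ∧ j ≠ k ∧ ∀ l, l ≠ i → l ≠ j → l ≠ k → h l = c := by
  decide +kernel

/-- A relation among the first four vectors, extended by 0, has five coefficients in a field of
three elements, so some value `c` occurs twice. Subtracting `c` times the zero sum leaves at most
three terms. One or two nonzero terms contradict the distinctness of the ten points, and three give
a line in the cap. Hence all coefficients equal `c`, and the appended 0 gives `c = 0`. -/
theorem IsCap.isFrame {C : Finset (AG 4)} (hC : IsCap C) {a : AG 4} {v : Fin 5 → AG 4}
    (hsum : ∑ i, v i = 0) (hcard : (lineUnion a v).card = 10) (hsub : lineUnion a v ⊆ C) : IsFrame v := by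
  refine ⟨?_, hsum⟩
  have hinj : ∀ {i j : Fin 5} {s t : ZMod 3}, s ≠ 0 → t ≠ 0 → s • v i = t • v j →
      (i, s) = (j, t) := by
    intro i j s t hs ht h
    refine Finset.card_image_iff.1 (hcard.trans (by decide)) (show (i, s) ∈ _ by simpa using hs)
      (show (j, t) ∈ _ by simpa using ht) ?_
    simp only [h]
  have hone : ∀ {i : Fin 5} {s : ZMod 3}, s • v i = 0 → s = 0 := by
    intro i s h
    by_contra hs
    have h2 : s = -s := congrArg Prod.snd
      (hinj hs (neg_ne_zero.2 hs) (i := i) (j := i) (by rw [neg_smul, h, neg_zero]))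
    revert hs h2
    clear * -
    revert s
    decide
  have htwo : ∀ {i j : Fin 5} {s t : ZMod 3}, i ≠ j → s • v i + t • v j = 0 → s = 0 ∧ t = 0 := by
    intro i j s t hij h
    by_cases hs : s = 0
    · subst hs
      exact ⟨rfl, hone (by simpa using h)⟩
    · by_cases ht : t = 0
      · subst ht
        exact ⟨hone (by simpa using h), rfl⟩
      · refine absurd (congrArg Prod.fst (hinj hs (neg_ne_zero.2 ht) (i := i) (j := j) ?_)) hij
        rw [neg_smul]
        exact eq_neg_of_add_eq_zero_left h
  have hmem : ∀ {i : Fin 5} {s : ZMod 3}, s ≠ 0 → a + s • v i ∈ C := fun hs =>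
    hsub (mem_lineUnion.2 ⟨_, _, hs, rfl⟩)
  have hthree : ∀ {i j k : Fin 5} {s t w : ZMod 3}, i ≠ j → i ≠ k → j ≠ k →
      s • v i + t • v j + w • v k = 0 → s = 0 ∧ t = 0 ∧ w = 0 := by
    intro i j k s t w hij hik hjk h
    by_cases hs : s = 0
    · subst hs
      exact ⟨rfl, htwo hjk (by simpa using h)⟩
    by_cases ht : t = 0
    · subst ht
      exact (htwo hik (by simpa using h)).imp_right fun h => ⟨rfl, h⟩
    by_cases hw : w = 0
    · subst hw
      exact (htwo hij (by simpa using h)).imp_right fun h => ⟨h, rfl⟩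
    refine absurd (congrArg Prod.fst (hinj hs ht (add_left_cancel (hC.eq_of_add_eq_zero (hmem hs)
      (hmem ht) (hmem (i := k) hw) ?_)))) hij
    rw [add_three_eq, h]
  rw [Fintype.linearIndependent_iff]
  intro g hg
  obtain ⟨c, i, j, k, hij, hik, hjk, hl⟩ := exists_three_of_fin_five (Fin.snoc g 0)
  set h : Fin 5 → ZMod 3 := Fin.snoc g 0 with hh
  have hsum' : ∑ l, (h l - c) • v l = 0 := by
    simp_rw [sub_smul, Finset.sum_sub_distrib, ← Finset.smul_sum, hsum, smul_zero, sub_zero]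
    rw [Fin.sum_univ_castSucc, hh]
    simpa only [Fin.snoc_castSucc, Fin.snoc_last, zero_smul, add_zero] using hg
  rw [← Finset.sum_subset (Finset.subset_univ {i, j, k})] at hsum'
  · rw [Finset.sum_insert (by simp [hij, hik]), Finset.sum_insert (by simp [hjk]),
      Finset.sum_singleton, ← add_assoc] at hsum'
    obtain ⟨h1, h2, h3⟩ := hthree hij hik hjk hsum'
    have hc : ∀ l, h l = c := by
      intro l
      by_cases hli : l = i
      · rw [hli]; exact sub_eq_zero.1 h1
      by_cases hlj : l = j
      · rw [hlj]; exact sub_eq_zero.1 h2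
      by_cases hlk : l = k
      · rw [hlk]; exact sub_eq_zero.1 h3
      exact hl l hli hlj hlk
    intro l
    have e1 : h l.castSucc = g l := Fin.snoc_castSucc ..
    have e2 : h (Fin.last 4) = 0 := Fin.snoc_last ..
    rw [← e1, hc, ← hc (Fin.last 4), e2]
  · intro l _ hl'
    simp only [Finset.mem_insert, Finset.mem_singleton, not_or] at hl'
    rw [hl l hl'.1 hl'.2.1 hl'.2.2, sub_self, zero_smul]

/-! ### Double counting of hyperplane sections -/

theorem card_dotProduct_eq_zero {k : ℕ} {u : Fin k → AG 4} (hu : LinearIndependent (ZMod 3) u) :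
    (Finset.univ.filter fun φ : AG 4 => ∀ i, u i ⬝ᵥ φ = 0).card * 3 ^ k = 81 := by
  have hrank : (Matrix.of u).rank = k := by simpa using hu.rank_matrix (M := Matrix.of u)
  have h1 := (Matrix.of u).mulVecLin.finrank_range_add_finrank_ker
  rw [← Matrix.rank, hrank, Module.finrank_fin_fun] at h1
  have h2 := Module.natCard_eq_pow_finrank (K := ZMod 3)
    (V := LinearMap.ker (Matrix.of u).mulVecLin)
  have h3 : Nat.card (LinearMap.ker (Matrix.of u).mulVecLin) =
      (Finset.univ.filter fun φ : AG 4 => ∀ i, u i ⬝ᵥ φ = 0).card := by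
    rw [← Fintype.card_subtype, ← Nat.card_eq_fintype_card]
    refine Nat.card_congr (Equiv.subtypeEquivRight fun φ => ?_)
    rw [LinearMap.mem_ker, Matrix.mulVecLin_apply, funext_iff]
    rfl
  rw [← h3, h2, Nat.card_zmod, ← pow_add, add_comm, h1]
  norm_num

/-- The points of `C` in the hyperplane `φ ⬝ᵥ x = t`. -/
def hyperplaneSection (C : Finset (AG 4)) (φ : AG 4) (t : ZMod 3) : Finset (AG 4) :=
  C.filter fun x => x ⬝ᵥ φ = t

/-- The points of `C` other than `x` in the hyperplane through `x` with normal vector `φ`. -/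
def otherPoints (C : Finset (AG 4)) (φ x : AG 4) : Finset (AG 4) :=
  (C.erase x).filter fun y => (y - x) ⬝ᵥ φ = 0

theorem card_otherPoints {C : Finset (AG 4)} {φ x : AG 4} (hx : x ∈ C) :
    (otherPoints C φ x).card + 1 = (hyperplaneSection C φ (x ⬝ᵥ φ)).card := by
  have : otherPoints C φ x = (hyperplaneSection C φ (x ⬝ᵥ φ)).erase x := by
    ext y
    simp [otherPoints, hyperplaneSection, sub_dotProduct, sub_eq_zero, and_assoc]
  rw [this, Finset.card_erase_add_one]
  simp [hyperplaneSection, hx]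

/-- Double counting: each `y ≠ x` is counted by 27 of the 81 vectors `φ`, the zero vector among
them. -/
theorem sum_card_otherPoints {C : Finset (AG 4)} {x : AG 4} (hx : x ∈ C) :
    ∑ φ, (otherPoints C φ x).card = (C.card - 1) * 27 := by
  have : ∑ φ, (otherPoints C φ x).card =
      ∑ y ∈ C.erase x, (Finset.univ.filter fun φ : AG 4 => (y - x) ⬝ᵥ φ = 0).card :=
    Finset.sum_card_bipartiteAbove_eq_sum_card_bipartiteBelow (s := Finset.univ) (t := C.erase x)
      (fun φ y => (y - x) ⬝ᵥ φ = 0)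
  rw [this, Finset.sum_const_nat (m := 27), Finset.card_erase_of_mem hx]
  intro y hy
  have hli : LinearIndependent (ZMod 3) ![y - x] :=
    LinearIndependent.of_subsingleton 0 (sub_ne_zero.2 (Finset.ne_of_mem_erase hy))
  have := card_dotProduct_eq_zero hli
  simp only [Fin.forall_fin_one, Matrix.cons_val_zero] at this
  omega

theorem IsCap.linearIndependent_pair {C : Finset (AG 4)} (hC : IsCap C) {x y z : AG 4}
    (hx : x ∈ C) (hy : y ∈ C) (hz : z ∈ C) (hxy : y ≠ x) (hxz : z ≠ x) (hyz : y ≠ z) :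
    LinearIndependent (ZMod 3) ![y - x, z - x] := by
  rw [LinearIndependent.pair_iff' (sub_ne_zero.2 hxy)]
  intro s h
  rcases eq_zero_or_one_or s with rfl | rfl | rfl
  · exact hxz (by simpa [eq_comm, sub_eq_zero] using h)
  · exact hyz (by simpa using h)
  · refine hxy (hC.eq_of_add_eq_zero hy hx hz ?_)
    have h1 : x + (y - x) + (z - x) + (x + x) = 0 := by
      have h3 : x + x + x = 0 := by rw [← neg_eq_add_self, neg_add_cancel]
      rw [← h]
      simp only [neg_smul, one_smul]
      rw [← h3]
      abel
    rw [← h1]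
    abel

/-- No three cap points are collinear, so the differences `y - x`, `z - x` are independent and 9
vectors `φ` annihilate both. -/
theorem sum_card_offDiag_otherPoints {C : Finset (AG 4)} (hC : IsCap C) {x : AG 4} (hx : x ∈ C) :
    ∑ φ, (otherPoints C φ x).offDiag.card = (C.erase x).offDiag.card * 9 := by
  have h1 : ∀ φ, (otherPoints C φ x).offDiag = (C.erase x).offDiag.filter
      fun p => (p.1 - x) ⬝ᵥ φ = 0 ∧ (p.2 - x) ⬝ᵥ φ = 0 := by
    intro φ
    ext p
    simp only [otherPoints, Finset.mem_offDiag, Finset.mem_filter]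
    tauto
  simp_rw [h1]
  have : ∑ φ, ((C.erase x).offDiag.filter
      fun p => (p.1 - x) ⬝ᵥ φ = 0 ∧ (p.2 - x) ⬝ᵥ φ = 0).card = ∑ p ∈ (C.erase x).offDiag,
      (Finset.univ.filter fun φ : AG 4 => (p.1 - x) ⬝ᵥ φ = 0 ∧ (p.2 - x) ⬝ᵥ φ = 0).card := by
    simp_rw [Finset.card_filter]
    exact Finset.sum_comm
  rw [this, Finset.sum_const_nat (m := 9)]
  rintro ⟨y, z⟩ hyz
  rw [Finset.mem_offDiag, Finset.mem_erase, Finset.mem_erase] at hyz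
  have := card_dotProduct_eq_zero
    (hC.linearIndependent_pair hx hyz.1.2 hyz.2.1.2 hyz.1.1 hyz.2.1.1 hyz.2.2)
  simp only [Fin.forall_fin_two, Matrix.cons_val_zero, Matrix.cons_val_one] at this
  dsimp only
  omega

theorem sum_hyperplaneSection (C : Finset (AG 4)) (φ : AG 4) (f : ℕ → ℤ) :
    ∑ x ∈ C, f (hyperplaneSection C φ (x ⬝ᵥ φ)).card =
      ∑ t : ZMod 3, ((hyperplaneSection C φ t).card : ℤ) * f (hyperplaneSection C φ t).card := by
  rw [← Finset.sum_fiberwise C (fun x => x ⬝ᵥ φ)]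
  refine Finset.sum_congr rfl fun t _ => ?_
  rw [Finset.sum_congr rfl (g := fun _ => f (hyperplaneSection C φ t).card)
    fun x hx => by rw [(Finset.mem_filter.1 hx).2]]
  simp [hyperplaneSection]

/-- The weight vanishes at sizes 8, 8, 4 and 7, 7, 6; with all sizes at most 9 it is negative only
for permutations of 9, 9, 2 and 9, 8, 3. -/
theorem exists_section_sizes : ∀ a b c : Fin 10, a.val + b.val + c.val = 20 →
    ((a.val * (5 * (a.val - 1) * (a.val - 2) - 78 * (a.val - 1)) +
      b.val * (5 * (b.val - 1) * (b.val - 2) - 78 * (b.val - 1)) +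
      c.val * (5 * (c.val - 1) * (c.val - 2) - 78 * (c.val - 1)) + 6192 : ℤ) < 0) →
    ∃ t₀ t₁ t₂ : Fin 3, t₀ ≠ t₁ ∧ t₀ ≠ t₂ ∧ t₁ ≠ t₂ ∧ ![a, b, c] t₀ = 9 ∧
      (![a, b, c] t₁ = 2 ∧ ![a, b, c] t₂ = 9 ∨ ![a, b, c] t₁ = 3 ∧ ![a, b, c] t₂ = 8) := by
  decide +kernel

theorem sum_card_hyperplaneSection (C : Finset (AG 4)) (φ : AG 4) :
    ∑ t : ZMod 3, (hyperplaneSection C φ t).card = C.card :=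
  (Finset.card_eq_sum_card_fiberwise (f := fun x => x ⬝ᵥ φ) (t := Finset.univ)
    fun _ _ => Finset.mem_coe.2 (Finset.mem_univ _)).symm

theorem IsCap.exists_section_sizes {C : Finset (AG 4)} (hC : IsCap C) (hcard : C.card = 20)
    (h9 : ∀ φ : AG 4, φ ≠ 0 → ∀ t, (hyperplaneSection C φ t).card ≤ 9) :
    ∃ φ : AG 4, φ ≠ 0 ∧ ∃ t₀ t₁ t₂ : ZMod 3, t₀ ≠ t₁ ∧ t₀ ≠ t₂ ∧ t₁ ≠ t₂ ∧
      (hyperplaneSection C φ t₀).card = 9 ∧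
      ((hyperplaneSection C φ t₁).card = 2 ∧ (hyperplaneSection C φ t₂).card = 9 ∨
        (hyperplaneSection C φ t₁).card = 3 ∧ (hyperplaneSection C φ t₂).card = 8) := by
  -- If `h` is the size of the section through a cap point, `h - 1` counts the other points in it
  -- and `(h - 1)(h - 2)` the ordered pairs of them, so both double counts apply.
  let f : ℕ → ℤ := fun h => 5 * (h - 1) * (h - 2) - 78 * (h - 1)
  let F : AG 4 → ℤ := fun φ => ∑ x ∈ C, f (hyperplaneSection C φ (x ⬝ᵥ φ)).card + 6192
  have hf : ∀ φ, ∀ x ∈ C, f (hyperplaneSection C φ (x ⬝ᵥ φ)).card =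
      5 * ((otherPoints C φ x).offDiag.card : ℤ) - 78 * ((otherPoints C φ x).card : ℤ) := by
    intro φ x hx
    simp only [f]
    rw [← card_otherPoints hx, Finset.offDiag_card, Nat.cast_sub (Nat.le_mul_self _)]
    push_cast
    ring
  have hsum : ∑ φ, F φ = 9072 := by
    simp only [F, Finset.sum_add_distrib]
    -- Contribution of one cap point: `5 * (19 * 18 * 9) - 78 * (19 * 27) = -24624`.
    rw [Finset.sum_comm, Finset.sum_congr rfl (g := fun _ => (-24624 : ℤ))]
    · simp [hcard]
    · intro x hx
      rw [Finset.sum_congr rfl fun φ _ => hf φ x hx, Finset.sum_sub_distrib, ← Finset.mul_sum,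
        ← Finset.mul_sum, ← Nat.cast_sum, ← Nat.cast_sum, sum_card_otherPoints hx,
        sum_card_offDiag_otherPoints hC hx, Finset.offDiag_card, Finset.card_erase_of_mem hx, hcard]
      norm_num
  have h0 : F 0 = 10752 := by
    have : ∀ x : AG 4, hyperplaneSection C 0 (x ⬝ᵥ (0 : AG 4)) = C := fun x => by simp [hyperplaneSection]
    simp only [F, this, hcard, f]
    simp [hcard]
  -- The nonzero `φ` contribute `9072 - 10752 < 0` in total.
  obtain ⟨φ, hφ, hneg⟩ : ∃ φ ∈ Finset.univ.erase (0 : AG 4), F φ < 0 := by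
    by_contra! h
    have := Finset.sum_nonneg h
    have h2 := Finset.add_sum_erase Finset.univ F (Finset.mem_univ 0)
    rw [hsum, h0] at h2
    linarith
  have hφ0 := Finset.ne_of_mem_erase hφ
  refine ⟨φ, hφ0, ?_⟩
  have hs := sum_card_hyperplaneSection C φ
  simp only [F, sum_hyperplaneSection] at hneg
  have h3 : ∀ g : ZMod 3 → ℤ, ∑ t : ZMod 3, g t = g 0 + g 1 + g 2 := fun g => Fin.sum_univ_three g
  have h3' : ∀ g : ZMod 3 → ℕ, ∑ t : ZMod 3, g t = g 0 + g 1 + g 2 := fun g => Fin.sum_univ_three g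
  rw [h3] at hneg
  rw [h3', hcard] at hs
  have hlt := fun t => Nat.lt_succ_of_le (h9 φ hφ0 t)
  obtain ⟨t₀, t₁, t₂, h01, h02, h12, h⟩ := _root_.exists_section_sizes ⟨_, hlt 0⟩ ⟨_, hlt 1⟩
    ⟨_, hlt 2⟩ hs hneg
  refine ⟨t₀, t₁, t₂, h01, h02, h12, ?_⟩
  have key : ∀ (t : Fin 3) (n : Fin 10),
      (![⟨_, hlt 0⟩, ⟨_, hlt 1⟩, ⟨_, hlt 2⟩] : Fin 3 → Fin 10) t = n →
        (hyperplaneSection C φ t).card = n.val := by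
    intro t n h
    rw [← h]
    fin_cases t <;> rfl
  exact ⟨key _ _ h.1, h.2.imp (And.imp (key _ _) (key _ _)) (And.imp (key _ _) (key _ _))⟩

/-! ### Affine normalization -/

/-- If the differences from `q` spanned dimension at most two, their span would have at most nine
elements and the differences would fill it; then `q`, `q + w`, `q - w` would be a line in `S`. -/
theorem IsCap.exists_independent {S : Finset (AG 4)} (hS : IsCap S) (h9 : 9 ≤ S.card) :
    ∃ q ∈ S, ∃ u : Fin 3 → AG 4, LinearIndependent (ZMod 3) u ∧ ∀ i, q + u i ∈ S := by
  obtain ⟨q, hq⟩ := Finset.card_pos.1 (by omega : 0 < S.card)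
  refine ⟨q, hq, ?_⟩
  set T : Set (AG 4) := {x | q + x ∈ S} with hT
  obtain ⟨f, hf, -, hli⟩ := Submodule.exists_fun_fin_finrank_span_eq (ZMod 3) T
  by_cases h3 : 3 ≤ Module.finrank (ZMod 3) (Submodule.span (ZMod 3) T)
  · exact ⟨f ∘ Fin.castLE h3, hli.comp _ (Fin.castLE_injective h3), fun i => hf _⟩
  exfalso
  have hTcard : T.ncard = S.card := by
    have : T = (S.image fun x => x - q : Finset (AG 4)) := by
      ext x
      simp only [hT, Set.mem_ofPred_eq, Finset.coe_image, Set.mem_image, Finset.mem_coe]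
      exact ⟨fun h => ⟨_, h, by simp⟩, fun ⟨y, hy, h⟩ => by rw [← h]; simpa using hy⟩
    rw [this, Set.ncard_coe_finset, Finset.card_image_of_injective _ sub_left_injective]
  have hspan : (Submodule.span (ZMod 3) T : Set (AG 4)).ncard ≤ 9 := by
    rw [← Nat.card_coe_set_eq]
    have := Module.natCard_eq_pow_finrank (K := ZMod 3) (V := Submodule.span (ZMod 3) T)
    rw [Nat.card_zmod] at this
    refine this.trans_le ((Nat.pow_le_pow_right (by norm_num) (by omega : _ ≤ 2)).trans ?_)
    norm_num
  have hTspan : T = Submodule.span (ZMod 3) T :=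
    Set.eq_of_subset_of_ncard_le Submodule.subset_span (by omega)
  obtain ⟨w, hw, hw0⟩ : ∃ w ∈ T, w ≠ 0 := by
    obtain ⟨x, hx, hxq⟩ := Finset.exists_mem_ne (by omega : 1 < S.card) q
    exact ⟨x - q, by simpa [hT] using hx, sub_ne_zero.2 hxq⟩
  have hw' : -w ∈ T := by
    rw [hTspan] at hw ⊢
    exact neg_mem hw
  have := hS.eq_of_add_eq_zero hq hw hw' (by
    have := add_three_eq q 0 w (-w)
    simpa using this)
  exact hw0 (by simpa using this)

theorem IsCap.image {C : Finset (AG 4)} (hC : IsCap C) (a : AG 4) (g : AG 4 ≃ₗ[ZMod 3] AG 4) :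
    IsCap (C.image fun x => a + g x) := by
  intro x hx y hy z hz ⟨hxy, hxz, hyz, h⟩
  obtain ⟨x, hx', rfl⟩ := Finset.mem_image.1 hx
  obtain ⟨y, hy', rfl⟩ := Finset.mem_image.1 hy
  obtain ⟨z, hz', rfl⟩ := Finset.mem_image.1 hz
  rw [add_three_eq, ← map_add, ← map_add, map_eq_zero_iff g g.injective] at h
  exact hC x hx' y hy' z hz' ⟨fun e => hxy (by rw [e]), fun e => hxz (by rw [e]), fun e => hyz (by rw [e]), h⟩

theorem move_injective (a : AG 4) (g : AG 4 ≃ₗ[ZMod 3] AG 4) :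
    Function.Injective fun x => a + g x := (add_right_injective a).comp g.injective

theorem card_image_move (C : Finset (AG 4)) (a : AG 4) (g : AG 4 ≃ₗ[ZMod 3] AG 4) :
    (C.image fun x => a + g x).card = C.card :=
  Finset.card_image_of_injective _ (move_injective a g)

theorem image_move_image_move (C : Finset (AG 4)) (a : AG 4) (g : AG 4 ≃ₗ[ZMod 3] AG 4) :
    (C.image fun x => a + g x).image (fun x => -g.symm a + g.symm x) = C := by
  rw [Finset.image_image]
  rw [show (fun x => -g.symm a + g.symm x) ∘ (fun x => a + g x) = id from funext fun x => by simp,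
    Finset.image_id]

theorem lineUnion_image (b : AG 4) (v : Fin 5 → AG 4) (a : AG 4) (g : AG 4 ≃ₗ[ZMod 3] AG 4) :
    (lineUnion b v).image (fun x => a + g x) = lineUnion (a + g b) (g ∘ v) := by
  rw [lineUnion, lineUnion, Finset.image_image]
  congr 1
  funext s
  simp [add_assoc]

theorem IsFrame.map {v : Fin 5 → AG 4} (hv : IsFrame v) (g : AG 4 ≃ₗ[ZMod 3] AG 4) :
    IsFrame (g ∘ v) := by
  refine ⟨hv.1.map' g.toLinearMap g.ker, ?_⟩
  rw [← map_zero g, ← hv.2, map_sum]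
  rfl

/-- Use the coordinates of `x - p` in the basis of three differences inside the section `t₀`
followed by `q - p`. Since `φ` kills the first three, the last coordinate records the value of `φ`.
-/
theorem IsCap.exists_normalization {C : Finset (AG 4)} (hC : IsCap C) {φ : AG 4} {t₀ t₁ : ZMod 3}
    (ht : t₀ ≠ t₁) (h9 : 9 ≤ (hyperplaneSection C φ t₀).card) {q : AG 4} (hq : q ⬝ᵥ φ = t₁) :
    ∃ (a : AG 4) (g : AG 4 ≃ₗ[ZMod 3] AG 4),
      0 ∈ C.image (fun x => a + g x) ∧
      (∀ i : Fin 3, Pi.single i.castSucc 1 ∈ C.image (fun x => a + g x)) ∧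
      a + g q = Pi.single 3 1 ∧
      ∀ s, (hyperplaneSection C φ (t₀ + s * (t₁ - t₀))).card =
        ((C.image fun x => a + g x).filter fun x => x 3 = s).card := by
  have hsec : IsCap (hyperplaneSection C φ t₀) := fun x hx y hy z hz =>
    hC x (Finset.filter_subset _ _ hx) y (Finset.filter_subset _ _ hy) z
      (Finset.filter_subset _ _ hz)
  obtain ⟨p, hp, u, hu, hup⟩ := hsec.exists_independent h9
  simp only [hyperplaneSection, Finset.mem_filter] at hp hup
  have huφ : ∀ i, u i ⬝ᵥ φ = 0 := fun i => by
    have := (hup i).2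
    rwa [add_dotProduct, hp.2, add_eq_left] at this
  have hqφ : (q - p) ⬝ᵥ φ = t₁ - t₀ := by rw [sub_dotProduct, hq, hp.2]
  have hli : LinearIndependent (ZMod 3) (Fin.snoc u (q - p) : Fin 4 → AG 4) := by
    rw [linearIndependent_finSnoc]
    refine ⟨hu, fun h => ht (sub_eq_zero.1 ?_).symm⟩
    have hspan : ∀ x ∈ Submodule.span (ZMod 3) (Set.range u), x ⬝ᵥ φ = 0 := fun x hx => by
      induction hx using Submodule.span_induction with
      | mem x hx => obtain ⟨i, rfl⟩ := hx; exact huφ i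
      | zero => exact zero_dotProduct φ
      | add x y _ _ hx hy => rw [add_dotProduct, hx, hy, add_zero]
      | smul s x _ hx => rw [smul_dotProduct, hx, smul_zero]
    rw [← hqφ, hspan _ h]
  let b := basisOfLinearIndependentOfCardEqFinrank hli (by simp)
  have hb : ∀ i, b i = (Fin.snoc u (q - p) : Fin 4 → AG 4) i := fun i => by simp [b]
  let g : AG 4 ≃ₗ[ZMod 3] AG 4 := b.equivFun
  have hg : ∀ x, -g p + g x = g (x - p) := fun x => by rw [map_sub]; abel
  have hgb : ∀ i, g (b i) = Pi.single i 1 := fun i => by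
    funext j
    simp [g, Pi.single_apply, eq_comm]
  have hφ : ∀ x, x ⬝ᵥ φ = t₀ + (-g p + g x) 3 * (t₁ - t₀) := by
    intro x
    have h1 := b.sum_equivFun (x - p)
    have h2 : (x - p) ⬝ᵥ φ = g (x - p) 3 * (t₁ - t₀) := by
      conv_lhs => rw [← h1]
      rw [sum_dotProduct, Fin.sum_univ_castSucc, Finset.sum_eq_zero]
      · rw [zero_add, smul_dotProduct, hb, Fin.snoc_last, hqφ]
        rfl
      · intro i _
        rw [smul_dotProduct, hb, Fin.snoc_castSucc, huφ, smul_zero]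
    rw [hg, ← h2, sub_dotProduct, hp.2]
    abel
  refine ⟨-g p, g, Finset.mem_image.2 ⟨p, hp.1, by simp⟩, fun i => ?_, ?_, fun s => ?_⟩
  · refine Finset.mem_image.2 ⟨p + u i, (hup i).1, ?_⟩
    rw [hg, add_sub_cancel_left, ← hgb, hb, Fin.snoc_castSucc]
  · rw [hg, ← hgb, hb]
    rfl
  · rw [Finset.filter_image, card_image_move, hyperplaneSection]
    congr 1
    refine Finset.filter_congr fun x _ => ?_
    rw [hφ]
    have h0 : t₁ - t₀ ≠ 0 := sub_ne_zero.2 ht.symm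
    rw [add_right_inj, mul_left_inj' h0]

/-! ### Every cap with at least 20 points contains a demicap -/

theorem free_nodup {ch L : List ℕ} (hL : L.Nodup) : (free ch L).Nodup := hL.filter _

theorem notMem_of_mem_free {ch L : List ℕ} {x : ℕ} (hx : x ∈ free ch L) : x ∉ ch := by
  have := (List.mem_filter.1 hx).2
  simp only [Bool.and_eq_true, Bool.not_eq_true', List.contains_eq_mem, decide_eq_false_iff_not]
    at this
  exact this.1

theorem mem_of_mem_free {ch L : List ℕ} {x : ℕ} (hx : x ∈ free ch L) : x ∈ L :=
  (List.mem_filter.1 hx).1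

theorem blockMask_cons (a : ℕ) (l : List ℕ) :
    blockMask (a :: l) = Nat.lor (blockMask l) (Nat.shiftRight zeroSumMask a) := rfl

theorem baseCodes_subset {C : Finset (AG 4)} (h0 : 0 ∈ C)
    (h : ∀ i : Fin 3, Pi.single i.castSucc 1 ∈ C) : ∀ x ∈ baseCodes, x ∈ C.image code := by
  intro x hx
  simp only [baseCodes, List.mem_cons, List.not_mem_nil, or_false] at hx
  rcases hx with rfl | rfl | rfl | rfl
  exacts [Finset.mem_image.2 ⟨_, h0, rfl⟩, Finset.mem_image.2 ⟨_, h 0, rfl⟩,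
    Finset.mem_image.2 ⟨_, h 1, rfl⟩, Finset.mem_image.2 ⟨_, h 2, rfl⟩]

theorem IsCap.card_layer_le {C : Finset (AG 4)} (hC : IsCap C) (h0 : 0 ∈ C)
    (h : ∀ i : Fin 3, Pi.single i.castSucc 1 ∈ C) : (C.filter fun x => x 3 = 0).card ≤ 9 := by
  by_contra! hlt
  have h1 := card_le_countP (L := layer) (Finset.filter_subset (fun x => x 3 = 0) C)
    fun x hx => code_mem_layer (Finset.mem_filter.1 hx).2
  have hbase := baseCodes_subset h0 h
  have h2 := countP_le_free hC.isCodeCap hbase (show layer.Nodup by decide)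
  have h4 : baseCodes.length = 4 := rfl
  obtain ⟨_, _, hk, -⟩ := capSearch_spec hC.isCodeCap 30 6 baseCodes _ _ [] capSearch_layer rfl
    hbase (free_nodup (by decide)) (fun x => notMem_of_mem_free) (by omega)
  exact Bool.false_ne_true hk

theorem sum_get_cast {α : Type*} [AddCommMonoid α] {l : List α} {n : ℕ} (h : n = l.length) :
    ∑ i : Fin n, l.get (i.cast h) = l.sum := by
  subst h
  simp only [Fin.cast_refl, id, List.get_eq_getElem, Fin.sum_univ_getElem]

theorem IsCap.exists_lineUnion_subset_of_search {C : Finset (AG 4)} (hC : IsCap C) {m n : ℕ}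
    (hsearch : capSearch (sectionTest m n) 30 5 baseCodes (blockMask baseCodes)
      (free baseCodes layer) [] = true) (h0 : 0 ∈ C)
    (h : ∀ i : Fin 3, Pi.single i.castSucc 1 ∈ C) (h3 : Pi.single 3 1 ∈ C)
    (hc0 : 9 ≤ (C.filter fun x => x 3 = 0).card) (hc1 : m + 1 ≤ (C.filter fun x => x 3 = 1).card)
    (hc2 : n ≤ (C.filter fun x => x 3 = 2).card) :
    ∃ a v, IsFrame v ∧ lineUnion a v ⊆ C := by
  have hS := hC.isCodeCap
  have h0' := card_le_countP (L := layer) (Finset.filter_subset (fun x => x 3 = 0) C)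
    fun x hx => code_mem_layer (Finset.mem_filter.1 hx).2
  have h1' := card_le_countP (L := layer₁) (Finset.filter_subset (fun x => x 3 = 1) C)
    fun x hx => code_mem_layer₁ (Finset.mem_filter.1 hx).2
  have h2' := card_le_countP (L := layer₂) (Finset.filter_subset (fun x => x 3 = 2) C)
    fun x hx => code_mem_layer₂ (Finset.mem_filter.1 hx).2
  have hbase := baseCodes_subset h0 h
  have hfree := countP_le_free hS hbase (show layer.Nodup by decide)
  have h4 : baseCodes.length = 4 := rfl
  have h512 : 512 ∈ C.image code := Finset.mem_image.2 ⟨_, h3, rfl⟩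
  obtain ⟨ch, _, hk, hch, hch', -⟩ := capSearch_spec hS 30 5 baseCodes _ _ [] hsearch rfl
    hbase (free_nodup (by decide)) (fun x => notMem_of_mem_free) (by omega)
  have hlayer : ∀ x ∈ ch, x ∈ layer := fun x hx =>
    (hch' x hx).elim (fun h => (by decide : ∀ x ∈ baseCodes, x ∈ layer) x h) mem_of_mem_free
  have hne512 : 512 ∉ ch := fun h => absurd (hlayer _ h) (by decide)
  unfold sectionTest at hk
  rw [← blockMask_cons] at hk
  have herase : layer₁.countP (· ∈ C.image code) =
      (layer₁.erase 512).countP (· ∈ C.image code) + 1 := by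
    rw [(List.perm_cons_erase (show 512 ∈ layer₁ by decide)).countP_eq,
      List.countP_cons_of_pos (by simpa using Finset.mem_image.1 h512)]
  obtain ⟨ch₁, d, hk₁, hch₁, hch₁', hd, hdc⟩ := capSearch_spec hS 30 m _ _ _ _ hk rfl
    (by
      intro x hx
      rcases List.mem_cons.1 hx with rfl | hx
      exacts [h512, hch x hx])
    ((by decide : layer₁.Nodup).erase _)
    (by
      intro x hx hx'
      rcases List.mem_cons.1 hx' with rfl | hx'
      · exact absurd hx (by decide)
      · exact (by decide : ∀ x ∈ layer, x ∉ layer₁.erase 512) x (hlayer x hx') hx)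
    (by omega)
  rw [countP_keep hS hch h512 hne512] at hdc
  have hd₂ : d.Sublist layer₂ := by
    rw [keep_eq_filter] at hd
    exact hd.trans List.filter_sublist
  obtain ⟨ch₂, _, hk₂, hch₂, -⟩ := capSearch_spec hS 30 n ch₁ _ d [] hk₁ rfl hch₁
    ((by decide : layer₂.Nodup).sublist hd₂)
    (by
      intro x hx hx'
      have hx₂ := hd₂.subset hx
      rcases hch₁' x hx' with h | h
      · rcases List.mem_cons.1 h with rfl | h
        · exact absurd hx₂ (by decide)
        · exact (by decide : ∀ x ∈ layer, x ∉ layer₂) x (hlayer x h) hx₂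
      · exact (by decide : ∀ x ∈ layer₁.erase 512, x ∉ layer₂) x h hx₂)
    (by omega)
  obtain ⟨a, l, hl5, hsum, hnodup, hlC⟩ := exists_of_hasDemicap hch₂ hk₂
  have hneg : ∀ x, a - (x - a) = -(a + x) := fun x => by
    have h1 : a + a + a = 0 := by rw [← neg_eq_add_self, neg_add_cancel]
    calc a - (x - a) = (a + a + a) - a - x := by abel
      _ = _ := by rw [h1]; abel
  have hunion : lineUnion a (fun i => l.get (i.cast hl5.symm) - a) =
      (l ++ l.map fun x => -(a + x)).toFinset := by
    ext x
    rw [mem_lineUnion, List.mem_toFinset, List.mem_append, List.mem_map]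
    constructor
    · rintro ⟨i, s, hs, rfl⟩
      rcases eq_zero_or_one_or s with rfl | rfl | rfl
      · exact absurd rfl hs
      · exact .inl (by simp)
      · refine .inr ⟨_, List.get_mem l (i.cast hl5.symm), ?_⟩
        rw [← hneg, neg_smul, one_smul, ← sub_eq_add_neg]
    · rintro (hx | ⟨y, hy, rfl⟩)
      · obtain ⟨i, rfl⟩ := List.get_of_mem hx
        exact ⟨i.cast hl5, 1, by decide, by simp⟩
      · obtain ⟨i, rfl⟩ := List.get_of_mem hy
        exact ⟨i.cast hl5, -1, by decide, by
          rw [← hneg, neg_smul, one_smul, ← sub_eq_add_neg]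
          simp⟩
  have hsub : lineUnion a (fun i => l.get (i.cast hl5.symm) - a) ⊆ C := fun x hx =>
    hlC x (by rwa [hunion, List.mem_toFinset] at hx)
  refine ⟨a, fun i => l.get (i.cast hl5.symm) - a, hC.isFrame ?_ ?_ hsub, hsub⟩
  · rw [Finset.sum_sub_distrib, sum_get_cast, hsum]
    have h1 : a + a + a = 0 := by rw [← neg_eq_add_self, neg_add_cancel]
    simp only [Finset.sum_const, Finset.card_univ, Fintype.card_fin]
    calc -a - 5 • a = -((a + a + a) + (a + a + a)) := by abel
      _ = 0 := by rw [h1]; simp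
  · rw [hunion, List.toFinset_card_of_nodup hnodup]
    simp [hl5]

theorem exists_dotProduct_eq {φ : AG 4} (hφ : φ ≠ 0) (t : ZMod 3) : ∃ q : AG 4, q ⬝ᵥ φ = t := by
  obtain ⟨i, hi⟩ := Function.ne_iff.1 hφ
  refine ⟨Pi.single i (t * (φ i)⁻¹), ?_⟩
  rw [single_dotProduct, mul_assoc, inv_mul_cancel₀ hi, mul_one]

theorem IsCap.card_hyperplaneSection_le {C : Finset (AG 4)} (hC : IsCap C) {φ : AG 4} (hφ : φ ≠ 0)
    (t : ZMod 3) : (hyperplaneSection C φ t).card ≤ 9 := by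
  by_contra! h
  -- The point `q` need not lie in `C`; it only supplies the fourth basis vector.
  obtain ⟨q, hq⟩ := exists_dotProduct_eq hφ (t + 1)
  obtain ⟨a, g, h0, h1, -, hcard⟩ := hC.exists_normalization (t₀ := t) (by simp) h.le hq
  have := (hC.image a g).card_layer_le h0 h1
  rw [← hcard, zero_mul, add_zero] at this
  omega

theorem IsCap.exists_lineUnion_subset {C : Finset (AG 4)} (hC : IsCap C) (h20 : 20 ≤ C.card) :
    ∃ a v, IsFrame v ∧ lineUnion a v ⊆ C := by
  -- The moment count is calibrated to exactly 20 points.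
  obtain ⟨C', hsub, hcard⟩ := Finset.exists_subset_card_eq h20
  have hC' : IsCap C' := fun x hx y hy z hz => hC x (hsub hx) y (hsub hy) z (hsub hz)
  suffices ∃ a v, IsFrame v ∧ lineUnion a v ⊆ C' by
    obtain ⟨a, v, hv, h⟩ := this
    exact ⟨a, v, hv, h.trans hsub⟩
  obtain ⟨φ, -, t₀, t₁, t₂, h01, h02, h12, hc0, hc⟩ :=
    hC'.exists_section_sizes hcard fun φ hφ => hC'.card_hyperplaneSection_le hφ
  obtain ⟨q, hq⟩ : (hyperplaneSection C' φ t₁).Nonempty := by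
    rw [← Finset.card_pos]
    omega
  rw [hyperplaneSection, Finset.mem_filter] at hq
  obtain ⟨a, g, h0, h1, h3, hs⟩ := hC'.exists_normalization h01 hc0.ge hq.2
  have hs0 := hs 0
  have hs1 := hs 1
  have hs2 := hs 2
  have ht2 : t₀ + 2 * (t₁ - t₀) = t₂ := by
    revert h01 h02 h12
    clear * -
    revert t₀ t₁ t₂
    decide
  rw [zero_mul, add_zero] at hs0
  rw [one_mul, add_sub_cancel] at hs1
  rw [ht2] at hs2
  have h3' : Pi.single 3 1 ∈ C'.image fun x => a + g x := h3 ▸ Finset.mem_image_of_mem _ hq.1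
  have key : ∃ b v, IsFrame v ∧ lineUnion b v ⊆ C'.image fun x => a + g x := by
    rcases hc with ⟨hc1, hc2⟩ | ⟨hc1, hc2⟩
    · exact (hC'.image a g).exists_lineUnion_subset_of_search capSearch_sectionTest_one_nine h0 h1
        h3' (by omega) (by omega) (by omega)
    · exact (hC'.image a g).exists_lineUnion_subset_of_search capSearch_sectionTest_two_eight h0 h1
        h3' (by omega) (by omega) (by omega)
  obtain ⟨b, v, hv, hb⟩ := key
  refine ⟨-g.symm a + g.symm b, g.symm ∘ v, hv.map g.symm, ?_⟩
  rw [← lineUnion_image b v (-g.symm a), ← image_move_image_move C' a g]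
  exact Finset.image_subset_image hb

/-! ### The six maximal caps above the standard demicap -/

/-- The point with a given code. -/
def decode (n : ℕ) : AG 4 :=
  ![((n % 8 : ℕ) : ZMod 3), ((n / 8 % 8 : ℕ) : ZMod 3), ((n / 64 % 8 : ℕ) : ZMod 3),
    ((n / 512 % 8 : ℕ) : ZMod 3)]

/-- The points of a list and their negatives. -/
def symmetrize (r : List (AG 4)) : Finset (AG 4) := (r ++ r.map (- ·)).toFinset

theorem map_code_append_neg (r : List (AG 4)) :
    (r ++ r.map (- ·)).map code = withNeg (r.map code) := by
  rw [withNeg, List.map_append, List.map_map, List.map_map]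
  congr 1
  exact List.map_congr_left fun x _ => (negCode_code x).symm

theorem mem_symmetrize_iff {r : List (AG 4)} {x : AG 4} :
    x ∈ symmetrize r ↔ code x ∈ withNeg (r.map code) := by
  rw [← map_code_append_neg, symmetrize, List.mem_toFinset,
    List.mem_map_of_injective code_injective]

theorem map_code_map_decode : ∀ l ∈ capReps, (l.map decode).map code = l := by decide +kernel

theorem nodup_withNeg_capReps : ∀ l ∈ capReps, (withNeg l).Nodup := by decide +kernel

theorem length_withNeg_capReps : ∀ l ∈ capReps, (withNeg l).length = 20 := by decide +kernel

theorem notMem_withNeg_capReps : ∀ l ∈ capReps, ∀ a ∈ withNeg l, ∀ p ∈ withNeg l, a ≠ p →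
    memCode (negCode (mod3 (a + p))) (withNeg l) = false := by
  decide +kernel

theorem stdCodes_subset_capReps : ∀ l ∈ capReps, ∀ x ∈ stdCodes, x ∈ withNeg l := by
  decide +kernel

theorem capReps_injective : ∀ l ∈ capReps, ∀ l' ∈ capReps, (∀ x ∈ l, x ∈ withNeg l') → l = l' := by
  decide +kernel

/-- Rules out 21 points: ten from the standard demicap and eleven more. -/
theorem capSearch_eleven :
    capSearch (fun _ _ _ => false) 40 11 stdCodes (blockMask stdCodes) (free stdCodes allCodes) []
      = true := by decide +kernel

/-- The six caps of size twenty that contain the standard demicap. -/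
def stdCap (l : List ℕ) : Finset (AG 4) := symmetrize (l.map decode)

theorem mem_stdCap {l : List ℕ} (hl : l ∈ capReps) {x : AG 4} :
    x ∈ stdCap l ↔ code x ∈ withNeg l := by
  rw [stdCap, mem_symmetrize_iff, map_code_map_decode l hl]

theorem nodup_stdCap {l : List ℕ} (hl : l ∈ capReps) :
    (l.map decode ++ (l.map decode).map (- ·)).Nodup := by
  refine List.Nodup.of_map code ?_
  rw [map_code_append_neg, map_code_map_decode l hl]
  exact nodup_withNeg_capReps l hl

theorem card_stdCap {l : List ℕ} (hl : l ∈ capReps) : (stdCap l).card = 20 := by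
  rw [stdCap, symmetrize, List.toFinset_card_of_nodup (nodup_stdCap hl)]
  have := length_withNeg_capReps l hl
  simpa [withNeg] using this

theorem isCap_stdCap {l : List ℕ} (hl : l ∈ capReps) : IsCap (stdCap l) := by
  rintro x hx y hy z hz ⟨hxy, -, -, h⟩
  rw [mem_stdCap hl] at hx hy hz
  have h1 := notMem_withNeg_capReps l hl _ hx _ hy (code_injective.ne hxy)
  rw [mod3_code_add, negCode_code, neg_eq_of_add_eq_zero_right h] at h1
  rw [memCode_iff.2 hz] at h1
  exact absurd h1.symm Bool.false_ne_true

/-- The unit vectors and the negative of their sum. -/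
def stdFrame : Fin 5 → AG 4 :=
  Fin.snoc (fun i => Pi.single i 1) (-∑ i : Fin 4, Pi.single i 1)

theorem IsFrame.exists_eq {v : Fin 5 → AG 4} (hv : IsFrame v) :
    ∃ g : AG 4 ≃ₗ[ZMod 3] AG 4, v = g ∘ stdFrame := by
  let b := basisOfLinearIndependentOfCardEqFinrank hv.1 (by simp)
  have hb : ∀ i : Fin 4, b.equivFun.symm (Pi.single i 1) = v i.castSucc := fun i => by
    simp [b]
  refine ⟨b.equivFun.symm, funext fun i => ?_⟩
  induction i using Fin.lastCases with
  | cast i => rw [Function.comp_apply, stdFrame, Fin.snoc_castSucc, hb]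
  | last =>
    rw [Function.comp_apply, stdFrame, Fin.snoc_last, map_neg, map_sum]
    simp_rw [hb]
    have := hv.2
    rw [Fin.sum_univ_castSucc] at this
    exact (neg_eq_of_add_eq_zero_right this).symm

theorem IsFrame.exists_lineUnion_eq {v : Fin 5 → AG 4} (hv : IsFrame v) (a : AG 4) :
    ∃ g : AG 4 ≃ₗ[ZMod 3] AG 4, lineUnion a v = (lineUnion 0 stdFrame).image fun x => a + g x := by
  obtain ⟨g, rfl⟩ := hv.exists_eq
  exact ⟨g, by rw [lineUnion_image, map_zero, add_zero]⟩

theorem image_code_lineUnion_stdFrame :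
    (lineUnion 0 stdFrame).image code = stdCodes.toFinset := by
  decide +kernel

theorem stdCodes_subset_image {C : Finset (AG 4)} (h : lineUnion 0 stdFrame ⊆ C) :
    ∀ x ∈ stdCodes, x ∈ C.image code := fun x hx => by
  refine Finset.image_subset_image h ?_
  rw [image_code_lineUnion_stdFrame]
  exact List.mem_toFinset.2 hx

theorem lineUnion_stdFrame_subset {l : List ℕ} (hl : l ∈ capReps) :
    lineUnion 0 stdFrame ⊆ stdCap l := fun x hx => by
  rw [mem_stdCap hl]
  refine stdCodes_subset_capReps l hl _ ?_
  rw [← List.mem_toFinset, ← image_code_lineUnion_stdFrame]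
  exact Finset.mem_image_of_mem _ hx

theorem IsCap.card_le_countP_free {C : Finset (AG 4)} (hC : IsCap C)
    (h : lineUnion 0 stdFrame ⊆ C) :
    C.card ≤ (free stdCodes allCodes).countP (· ∈ C.image code) + 10 :=
  (card_le_countP (Finset.Subset.refl C) fun x _ => code_mem_allCodes x).trans
    (countP_le_free hC.isCodeCap (stdCodes_subset_image h) (by decide))

theorem IsCap.card_le_of_stdFrame {C : Finset (AG 4)} (hC : IsCap C)
    (h : lineUnion 0 stdFrame ⊆ C) : C.card ≤ 20 := by
  by_contra! hlt
  have := hC.card_le_countP_free h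
  obtain ⟨_, _, hk, -⟩ := capSearch_spec hC.isCodeCap 40 11 stdCodes _ _ [] capSearch_eleven rfl
    (stdCodes_subset_image h) (free_nodup (by decide)) (fun x => notMem_of_mem_free) (by omega)
  exact Bool.false_ne_true hk

theorem IsCap.exists_eq_stdCap {C : Finset (AG 4)} (hC : IsCap C)
    (h : lineUnion 0 stdFrame ⊆ C) (h20 : C.card = 20) : ∃ l ∈ capReps, C = stdCap l := by
  have := hC.card_le_countP_free h
  obtain ⟨ch, _, hk, hch, -⟩ := capSearch_spec hC.isCodeCap 40 10 stdCodes _ _ [] capSearch_capReps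
    rfl (stdCodes_subset_image h) (free_nodup (by decide)) (fun x => notMem_of_mem_free) (by omega)
  obtain ⟨l, hl, hsub⟩ := List.any_eq_true.1 hk
  rw [subCode_iff] at hsub
  refine ⟨l, hl, (Finset.eq_of_subset_of_card_le (fun x hx => ?_) ?_).symm⟩
  · exact code_mem_image.1 (hch _ (hsub _ ((mem_stdCap hl).1 hx)))
  · rw [card_stdCap hl, h20]

theorem image_move_symm_image_move (C : Finset (AG 4)) (a : AG 4) (g : AG 4 ≃ₗ[ZMod 3] AG 4) :
    (C.image fun x => -g.symm a + g.symm x).image (fun x => a + g x) = C := by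
  have h := image_move_image_move C (-g.symm a) g.symm
  simpa only [LinearEquiv.symm_symm, map_neg, LinearEquiv.apply_symm_apply, neg_neg] using h

theorem image_subset_iff_subset_image_symm {D C : Finset (AG 4)} {a : AG 4}
    {g : AG 4 ≃ₗ[ZMod 3] AG 4} :
    (D.image fun x => a + g x) ⊆ C ↔ D ⊆ C.image fun x => -g.symm a + g.symm x := by
  constructor
  · intro h
    have := Finset.image_subset_image (f := fun x => -g.symm a + g.symm x) h
    rwa [image_move_image_move] at this
  · intro h
    have := Finset.image_subset_image (f := fun x => a + g x) h
    rwa [image_move_symm_image_move] at this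

theorem IsCap.card_le_of_lineUnion {C : Finset (AG 4)} (hC : IsCap C) {a : AG 4} {v : Fin 5 → AG 4}
    (hv : IsFrame v) (h : lineUnion a v ⊆ C) : C.card ≤ 20 := by
  obtain ⟨g, hg⟩ := hv.exists_lineUnion_eq a
  rw [hg, image_subset_iff_subset_image_symm] at h
  rw [← card_image_move C (-g.symm a) g.symm]
  exact (hC.image _ _).card_le_of_stdFrame h

theorem IsCap.card_le {C : Finset (AG 4)} (hC : IsCap C) : C.card ≤ 20 := by
  by_contra! h
  obtain ⟨a, v, hv, hsub⟩ := hC.exists_lineUnion_subset h.le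
  exact absurd (hC.card_le_of_lineUnion hv hsub) (by omega)

theorem isMaximalCap_iff {C : Finset (AG 4)} : IsMaximalCap C ↔ IsCap C ∧ C.card = 20 := by
  have hne : [1, 8, 64, 512, 1170, 74, 529, 594, 642, 648] ∈ capReps := by decide
  refine ⟨fun h => ⟨h.1, h.1.card_le.antisymm ?_⟩, fun h => ⟨h.1, fun C' hC' => ?_⟩⟩
  · rw [← card_stdCap hne]
    exact h.2 _ (isCap_stdCap hne)
  · rw [h.2]
    exact hC'.card_le

theorem isDemicap_iff {D : Finset (AG 4)} :
    IsDemicap D ↔ ∃ a v, IsFrame v ∧ D = lineUnion a v := by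
  constructor
  · rintro ⟨a, h⟩
    exact ⟨a, h.exists_frame⟩
  · rintro ⟨a, v, hv, rfl⟩
    exact ⟨a, hv.isDemicapWithAnchor a⟩

theorem setOf_isMaximalCap_stdFrame :
    {C : Finset (AG 4) | IsMaximalCap C ∧ lineUnion 0 stdFrame ⊆ C} =
      stdCap '' {l | l ∈ capReps} := by
  ext C
  simp only [Set.mem_ofPred_eq, Set.mem_image, isMaximalCap_iff]
  constructor
  · rintro ⟨⟨hC, h20⟩, h⟩
    obtain ⟨l, hl, rfl⟩ := hC.exists_eq_stdCap h h20
    exact ⟨l, hl, rfl⟩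
  · rintro ⟨l, hl, rfl⟩
    exact ⟨⟨isCap_stdCap hl, card_stdCap hl⟩, lineUnion_stdFrame_subset hl⟩

theorem ncard_maximalCap_stdFrame :
    {C : Finset (AG 4) | IsMaximalCap C ∧ lineUnion 0 stdFrame ⊆ C}.ncard = 6 := by
  rw [setOf_isMaximalCap_stdFrame, Set.InjOn.ncard_image]
  · have : {l | l ∈ capReps} = (capReps.toFinset : Set (List ℕ)) := by simp
    rw [this, Set.ncard_coe_finset]
    decide
  · intro l hl l' hl' h
    refine capReps_injective l hl l' hl' fun x hx => ?_
    have hx' : x ∈ (l.map decode).map code := by rwa [map_code_map_decode l hl]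
    obtain ⟨y, hy, rfl⟩ := List.mem_map.1 hx'
    rw [← mem_stdCap hl', ← h, mem_stdCap hl, withNeg, List.mem_append]
    exact .inl hx

theorem IsMaximalCap.image {C : Finset (AG 4)} (hC : IsMaximalCap C) (a : AG 4)
    (g : AG 4 ≃ₗ[ZMod 3] AG 4) : IsMaximalCap (C.image fun x => a + g x) := by
  rw [isMaximalCap_iff] at hC ⊢
  exact ⟨hC.1.image a g, by rw [card_image_move, hC.2]⟩

theorem IsDemicap.ncard_maximalCap {D : Finset (AG 4)} (hD : IsDemicap D) :
    {C : Finset (AG 4) | IsMaximalCap C ∧ D ⊆ C}.ncard = 6 := by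
  obtain ⟨a, v, hv, rfl⟩ := isDemicap_iff.1 hD
  obtain ⟨g, hg⟩ := hv.exists_lineUnion_eq a
  have : {C : Finset (AG 4) | IsMaximalCap C ∧ lineUnion a v ⊆ C} =
      Finset.image (fun x => a + g x) ''
        {C : Finset (AG 4) | IsMaximalCap C ∧ lineUnion 0 stdFrame ⊆ C} := by
    ext C
    simp only [Set.mem_ofPred_eq, Set.mem_image, hg]
    constructor
    · rintro ⟨hC, h⟩
      exact ⟨_, ⟨hC.image _ _, image_subset_iff_subset_image_symm.1 h⟩,
        image_move_symm_image_move C a g⟩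
    · rintro ⟨C, ⟨hC, h⟩, rfl⟩
      exact ⟨hC.image _ _, Finset.image_subset_image h⟩
  rw [this, Set.ncard_image_of_injective _ (Finset.image_injective (move_injective a g)),
    ncard_maximalCap_stdFrame]

/-! ### Demicaps inside a maximal cap -/

/-- Whether `acc` and the elements of `b` with suitable signs add up to zero. -/
def signZero (b : List ℕ) (acc : ℕ) : Bool :=
  List.rec (motive := fun _ => ℕ → Bool) (fun acc => Nat.beq acc 0)
    (fun x _ ih acc =>
      Bool.rec (ih (mod3 (acc + negCode x))) true (ih (mod3 (acc + x)))) b acc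

theorem countP_signZero_capReps : ∀ l ∈ capReps,
    ((l.sublistsLen 5).countP fun b => signZero b 0) = 72 := by
  decide +kernel

/-- A demicap with anchor `a` has ten points `x ≠ a` whose reflection `-(a + x)` is again in the
cap; no `a ≠ 0` has that many. The point `a` itself is excluded because it is its own reflection. -/
theorem atLeast_ten_capReps : ∀ l ∈ capReps, ∀ a ∈ allCodes, a = 0 ∨
    atLeast 10 ((withNeg l).filter fun x =>
      !Nat.beq x a && memCode (negCode (mod3 (a + x))) (withNeg l)) = false := by
  decide +kernel

theorem signZero_iff (b : List (AG 4)) (acc : AG 4) : signZero (b.map code) (code acc) = true ↔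
    ∃ s : Fin b.length → ZMod 3, (∀ i, s i ≠ 0) ∧ acc + ∑ i, s i • b.get i = 0 := by
  induction b generalizing acc with
  | nil =>
    have h : signZero ([].map code) (code acc) = Nat.beq (code acc) (code 0) := rfl
    rw [h, Nat.beq_eq, code_injective.eq_iff]
    exact ⟨fun h => ⟨fun _ => 1, fun _ => one_ne_zero, by simpa using h⟩,
      fun ⟨s, _, h⟩ => by simpa using h⟩
  | cons x b ih =>
    have h : signZero ((x :: b).map code) (code acc) =
        (signZero (b.map code) (code (acc + x)) || signZero (b.map code) (code (acc + -x))) := by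
      rw [← mod3_code_add, ← mod3_code_add, ← negCode_code]
      change Bool.rec (motive := fun _ => Bool)
        (signZero (b.map code) (mod3 (code acc + negCode (code x)))) true
        (signZero (b.map code) (mod3 (code acc + code x))) = _
      cases signZero (b.map code) (mod3 (code acc + code x)) <;> rfl
    rw [h, Bool.or_eq_true, ih, ih]
    constructor
    · rintro (⟨s, hs, h⟩ | ⟨s, hs, h⟩)
      · refine ⟨Fin.cons 1 s, Fin.cases (by simp) hs, ?_⟩
        rw [← h, add_assoc]
        congr 1
        exact (Fin.sum_univ_succ _).trans (by simp)
      · refine ⟨Fin.cons (-1) s, Fin.cases (by simp) hs, ?_⟩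
        rw [← h, add_assoc]
        congr 1
        exact (Fin.sum_univ_succ _).trans (by simp)
    · rintro ⟨s, hs, h⟩
      have h' : acc + s 0 • x + ∑ i : Fin b.length, s i.succ • b.get i = 0 := by
        rw [← h, add_assoc]
        congr 1
        exact (Fin.sum_univ_succ fun i : Fin (b.length + 1) => s i • (x :: b).get i).symm
      rcases eq_zero_or_one_or (s 0) with h0 | h0 | h0
      · exact absurd h0 (hs 0)
      · refine .inl ⟨fun i => s i.succ, fun i => hs _, ?_⟩
        rwa [h0, one_smul] at h'
      · refine .inr ⟨fun i => s i.succ, fun i => hs _, ?_⟩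
        rwa [h0, neg_smul, one_smul] at h'

theorem List.map_sublistsLen {α β : Type*} (f : α → β) (n : ℕ) (l : List α) :
    (l.map f).sublistsLen n = (l.sublistsLen n).map (List.map f) := by
  induction l generalizing n with
  | nil => cases n <;> simp
  | cons x l ih =>
    cases n with
    | zero => simp
    | succ n =>
      rw [map_cons, sublistsLen_succ_cons, sublistsLen_succ_cons, ih, ih, map_append, map_map,
        map_map]
      rfl

theorem mem_symmetrize {r : List (AG 4)} {x : AG 4} :
    x ∈ symmetrize r ↔ ∃ y ∈ r, ∃ s : ZMod 3, s ≠ 0 ∧ x = s • y := by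
  rw [symmetrize, List.mem_toFinset, List.mem_append, List.mem_map]
  constructor
  · rintro (h | ⟨y, h, rfl⟩)
    · exact ⟨x, h, 1, by decide, by simp⟩
    · exact ⟨y, h, -1, by decide, by simp⟩
  · rintro ⟨y, h, s, hs, rfl⟩
    rcases eq_zero_or_one_or s with rfl | rfl | rfl
    · exact absurd rfl hs
    · exact .inl (by simpa using h)
    · exact .inr ⟨y, h, by simp⟩

theorem smul_smul_self {s : ZMod 3} (hs : s ≠ 0) (x : AG 4) : s • s • x = x := by
  have h1 : ∀ t : ZMod 3, t ≠ 0 → t * t = 1 := by decide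
  rw [smul_smul, h1 s hs, one_smul]

theorem symmetrize_eq_lineUnion {b : List (AG 4)} (hb : 5 = b.length) {s : Fin 5 → ZMod 3}
    (hs : ∀ i, s i ≠ 0) : symmetrize b = lineUnion 0 fun i => s i • b.get (i.cast hb) := by
  ext x
  rw [mem_symmetrize, mem_lineUnion]
  constructor
  · rintro ⟨y, hy, t, ht, rfl⟩
    obtain ⟨i, rfl⟩ := List.get_of_mem hy
    refine ⟨i.cast hb.symm, t * s (i.cast hb.symm), mul_ne_zero ht (hs _), ?_⟩
    rw [zero_add, mul_smul, smul_smul_self (hs _)]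
    rfl
  · rintro ⟨i, t, ht, rfl⟩
    exact ⟨_, List.get_mem b (i.cast hb), t * s i, mul_ne_zero ht (hs i), by
      rw [zero_add, mul_smul]⟩

theorem nodup_append_neg_of_sublist {r b : List (AG 4)} (hr : (r ++ r.map (- ·)).Nodup)
    (hb : b.Sublist r) : (b ++ b.map (- ·)).Nodup :=
  hr.sublist (hb.append (hb.map _))

theorem card_symmetrize {b : List (AG 4)} (hb : (b ++ b.map (- ·)).Nodup) :
    (symmetrize b).card = 2 * b.length := by
  rw [symmetrize, List.toFinset_card_of_nodup hb, List.length_append, List.length_map, two_mul]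

theorem neg_mem_lineUnion {v : Fin 5 → AG 4} {a x : AG 4} (hx : x ∈ lineUnion a v) :
    -(a + x) ∈ lineUnion a v := by
  obtain ⟨i, s, hs, rfl⟩ := mem_lineUnion.1 hx
  refine mem_lineUnion.2 ⟨i, -s, neg_ne_zero.2 hs, ?_⟩
  have h1 : a + a + a = 0 := by rw [← neg_eq_add_self, neg_add_cancel]
  calc -(a + (a + s • v i)) = (a + a + a) - (a + (a + s • v i)) := by rw [h1, zero_sub]
    _ = a + -(s • v i) := by abel
    _ = _ := by rw [neg_smul]

theorem IsFrame.smul_ne_zero {v : Fin 5 → AG 4} (hv : IsFrame v) {i : Fin 5} {s : ZMod 3}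
    (hs : s ≠ 0) : s • v i ≠ 0 := fun h => by
  have h2 : s = -s := congrArg Prod.snd (hv.injective hs (neg_ne_zero.2 hs) (i := i) (j := i)
    (by rw [neg_smul, h, neg_zero]))
  have : ∀ s : ZMod 3, s = -s → s = 0 := by decide
  exact hs (this s h2)

theorem IsFrame.eq_zero_of_subset_stdCap {l : List ℕ} (hl : l ∈ capReps) {a : AG 4}
    {v : Fin 5 → AG 4} (hv : IsFrame v) (h : lineUnion a v ⊆ stdCap l) : a = 0 := by
  refine code_injective (((atLeast_ten_capReps l hl _ (code_mem_allCodes a)).resolve_right ?_).trans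
    (show 0 = code 0 from rfl))
  rw [Bool.not_eq_false, atLeast_iff, ← hv.card_lineUnion a,
    ← Finset.card_image_of_injective _ code_injective]
  refine le_trans (Finset.card_le_card fun n hn => ?_) (List.toFinset_card_le _)
  obtain ⟨x, hx, rfl⟩ := Finset.mem_image.1 hn
  rw [List.mem_toFinset, List.mem_filter, Bool.and_eq_true, memCode_iff, mod3_code_add,
    negCode_code, ← mem_stdCap hl, ← mem_stdCap hl, Bool.not_eq_true', Bool.eq_false_iff,
    Ne, Nat.beq_eq]
  refine ⟨h hx, ?_, h (neg_mem_lineUnion hx)⟩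
  obtain ⟨i, s, hs, rfl⟩ := mem_lineUnion.1 hx
  exact code_injective.ne fun e => hv.smul_ne_zero hs (add_eq_left.1 e)

theorem eq_of_symmetrize_eq {r b b' : List (AG 4)} (hr : (r ++ r.map (- ·)).Nodup)
    (hb : b.Sublist r) (hb' : b'.Sublist r) (h : symmetrize b = symmetrize b') : b = b' := by
  have hrn : r.Nodup := (List.nodup_append.1 hr).1
  have key : ∀ {b b' : List (AG 4)}, b.Sublist r → b'.Sublist r → symmetrize b = symmetrize b' →
      ∀ x ∈ b, x ∈ b' := by
    intro b b' hb hb' h x hx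
    have : x ∈ symmetrize b' := by
      rw [← h, symmetrize, List.mem_toFinset]
      exact List.mem_append_left _ hx
    rw [symmetrize, List.mem_toFinset, List.mem_append] at this
    refine this.resolve_right fun hx' => ?_
    exact (List.nodup_append.1 hr).2.2 x (hb.subset hx) x ((hb'.map _).subset hx') rfl
  refine (hrn.perm_iff_eq_of_sublist hb hb').1 ((List.perm_ext_iff_of_nodup (hrn.sublist hb)
    (hrn.sublist hb')).2 fun x => ⟨key hb hb' h x, key hb' hb h.symm x⟩)

/-- The set is closed under negation and `r` has one point of each pair `±x`, so the members of `r`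
in it are five representatives. They are the frame vectors up to order and sign, and undoing the
signs gives sum zero. -/
theorem IsFrame.exists_sublist {r : List (AG 4)} (hr : (r ++ r.map (- ·)).Nodup)
    {v : Fin 5 → AG 4} (hv : IsFrame v) (h : lineUnion 0 v ⊆ symmetrize r) :
    ∃ b, b.Sublist r ∧ b.length = 5 ∧ signZero (b.map code) 0 = true ∧
      symmetrize b = lineUnion 0 v := by
  set b := r.filter (· ∈ lineUnion 0 v) with hb
  have hbr : b.Sublist r := List.filter_sublist
  have hbn := nodup_append_neg_of_sublist hr hbr
  have hmemb : ∀ y ∈ b, y ∈ lineUnion 0 v := fun y hy => by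
    simpa using (List.mem_filter.1 hy).2
  have hD : symmetrize b = lineUnion 0 v := by
    ext x
    rw [mem_symmetrize]
    constructor
    · rintro ⟨y, hy, t, ht, rfl⟩
      obtain ⟨i, s, hs, h⟩ := mem_lineUnion.1 (hmemb y hy)
      exact mem_lineUnion.2 ⟨i, t * s, mul_ne_zero ht hs, by rw [h, zero_add, zero_add, mul_smul]⟩
    · intro hx
      obtain ⟨y, hy, t, ht, rfl⟩ := mem_symmetrize.1 (h hx)
      refine ⟨y, List.mem_filter.2 ⟨hy, ?_⟩, t, ht, rfl⟩
      obtain ⟨i, s, hs, h⟩ := mem_lineUnion.1 hx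
      rw [decide_eq_true_eq, mem_lineUnion]
      refine ⟨i, t * s, mul_ne_zero ht hs, ?_⟩
      rw [zero_add, mul_smul, ← zero_add (s • v i), ← h, smul_smul_self ht]
  have h5 : b.length = 5 := by
    have := card_symmetrize hbn
    rw [hD, hv.card_lineUnion] at this
    omega
  refine ⟨b, hbr, h5, ?_, hD⟩
  have : ∀ k : Fin b.length, ∃ (i : Fin 5) (s : ZMod 3), s ≠ 0 ∧ s • b.get k = v i := by
    intro k
    obtain ⟨i, s, hs, h⟩ := mem_lineUnion.1 (hmemb _ (List.get_mem b k))
    exact ⟨i, s, hs, by rw [h, zero_add, smul_smul_self hs]⟩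
  choose idx s hs hidx using this
  have hinj : Function.Injective idx := by
    intro k k' hk
    have h1 : s k • b.get k = s k' • b.get k' := by rw [hidx, hidx, hk]
    have h2 : b.get k = (s k * s k') • b.get k' := by
      rw [mul_smul, ← h1, smul_smul_self (hs k)]
    have hbn' := List.nodup_append.1 hbn
    rcases eq_zero_or_one_or (s k * s k') with h | h | h
    · exact absurd h (mul_ne_zero (hs k) (hs k'))
    · rw [h, one_smul] at h2
      exact hbn'.1.injective_get h2
    · rw [h, neg_smul, one_smul] at h2
      exact absurd h2 (hbn'.2.2 _ (List.get_mem b k) _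
        (List.mem_map_of_mem (List.get_mem b k')))
  have hbij : Function.Bijective idx :=
    (Fintype.bijective_iff_injective_and_card idx).2 ⟨hinj, by simp [h5]⟩
  have := (signZero_iff b 0).2 ⟨s, hs, by
    rw [zero_add]
    simp_rw [hidx]
    rw [hbij.sum_comp v, hv.2]⟩
  exact this

theorem setOf_isDemicap_subset_stdCap {l : List ℕ} (hl : l ∈ capReps) :
    {D : Finset (AG 4) | IsDemicap D ∧ D ⊆ stdCap l} =
      symmetrize '' {b | b ∈ ((l.map decode).sublistsLen 5).filter
        fun b => signZero (b.map code) 0} := by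
  have hr := nodup_stdCap hl
  ext D
  simp only [Set.mem_ofPred_eq, Set.mem_image, List.mem_filter, List.mem_sublistsLen]
  constructor
  · rintro ⟨hD, h⟩
    obtain ⟨a, v, hv, rfl⟩ := isDemicap_iff.1 hD
    obtain rfl := hv.eq_zero_of_subset_stdCap hl h
    obtain ⟨b, hbr, h5, hb0, hbD⟩ := hv.exists_sublist hr h
    exact ⟨b, ⟨⟨hbr, h5⟩, hb0⟩, hbD⟩
  · rintro ⟨b, ⟨⟨hbr, h5⟩, hb0⟩, rfl⟩
    have hsub : symmetrize b ⊆ stdCap l := fun x hx => by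
      rw [stdCap, mem_symmetrize] at *
      obtain ⟨y, hy, h⟩ := hx
      exact ⟨y, hbr.subset hy, h⟩
    refine ⟨?_, hsub⟩
    obtain ⟨s, hs, h⟩ := (signZero_iff b 0).1 hb0
    have hu := symmetrize_eq_lineUnion h5.symm (s := fun i => s (i.cast h5.symm)) fun i => hs _
    have hcard := card_symmetrize (nodup_append_neg_of_sublist hr hbr)
    rw [h5] at hcard
    rw [hu] at hsub hcard ⊢
    refine isDemicap_iff.2 ⟨0, _, (isCap_stdCap hl).isFrame ?_ hcard hsub, rfl⟩
    rw [← h, zero_add]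
    exact (finCongr h5.symm).sum_comp fun i => s i • b.get i

theorem ncard_isDemicap_subset_stdCap {l : List ℕ} (hl : l ∈ capReps) :
    {D : Finset (AG 4) | IsDemicap D ∧ D ⊆ stdCap l}.ncard = 72 := by
  have hr := nodup_stdCap hl
  have hrn := (List.nodup_append.1 hr).1
  rw [setOf_isDemicap_subset_stdCap hl, Set.InjOn.ncard_image]
  · have : {b | b ∈ ((l.map decode).sublistsLen 5).filter fun b => signZero (b.map code) 0} =
        ((((l.map decode).sublistsLen 5).filter fun b => signZero (b.map code) 0).toFinset :
          Set (List (AG 4))) := by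
      ext; simp
    rw [this, Set.ncard_coe_finset,
      List.toFinset_card_of_nodup ((List.nodup_sublistsLen 5 hrn).filter _),
      ← List.countP_eq_length_filter, ← countP_signZero_capReps l hl]
    conv_rhs => rw [← map_code_map_decode l hl, List.map_sublistsLen, List.countP_map]
    rfl
  · intro b hb b' hb' h
    exact eq_of_symmetrize_eq hr (List.mem_sublistsLen.1 (List.mem_filter.1 hb).1).1
      (List.mem_sublistsLen.1 (List.mem_filter.1 hb').1).1 h

theorem IsDemicap.image {D : Finset (AG 4)} (hD : IsDemicap D) (a : AG 4)
    (g : AG 4 ≃ₗ[ZMod 3] AG 4) : IsDemicap (D.image fun x => a + g x) := by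
  obtain ⟨b, v, hv, rfl⟩ := isDemicap_iff.1 hD
  exact isDemicap_iff.2 ⟨_, _, hv.map g, lineUnion_image b v a g⟩

theorem IsMaximalCap.ncard_isDemicap {C : Finset (AG 4)} (hC : IsMaximalCap C) :
    {D : Finset (AG 4) | IsDemicap D ∧ D ⊆ C}.ncard = 72 := by
  have hC' := isMaximalCap_iff.1 hC
  obtain ⟨a, v, hv, hsub⟩ := hC'.1.exists_lineUnion_subset hC'.2.ge
  obtain ⟨g, hg⟩ := hv.exists_lineUnion_eq a
  rw [hg, image_subset_iff_subset_image_symm] at hsub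
  obtain ⟨l, hl, hCl⟩ := (hC'.1.image _ _).exists_eq_stdCap hsub (by rw [card_image_move, hC'.2])
  have : {D : Finset (AG 4) | IsDemicap D ∧ D ⊆ C} =
      Finset.image (fun x => a + g x) '' {D : Finset (AG 4) | IsDemicap D ∧ D ⊆ stdCap l} := by
    ext D
    simp only [Set.mem_ofPred_eq, Set.mem_image, ← hCl]
    constructor
    · rintro ⟨hD, h⟩
      exact ⟨_, ⟨hD.image _ _, Finset.image_subset_image h⟩, image_move_symm_image_move D a g⟩
    · rintro ⟨D, ⟨hD, h⟩, rfl⟩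
      exact ⟨hD.image _ _, image_subset_iff_subset_image_symm.2 h⟩
  rw [this, Set.ncard_image_of_injective _ (Finset.image_injective (move_injective a g)),
    ncard_isDemicap_subset_stdCap hl]

/-! ### Counting frames and anchored demicaps -/

theorem IsFrame.smul_comp {v : Fin 5 → AG 4} (hv : IsFrame v) (σ : Equiv.Perm (Fin 5)) {s : ZMod 3}
    (hs : s ≠ 0) : IsFrame fun i => s • v (σ i) := by
  constructor
  · refine Fintype.linearIndependent_iff.2 fun g hg i => ?_
    let h : Fin 5 → ZMod 3 := Fin.snoc g 0
    have h0 : ∑ i, h i • v (σ i) = 0 := by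
      rw [Fin.sum_univ_castSucc]
      simp only [h, Fin.snoc_castSucc, Fin.snoc_last, zero_smul, add_zero]
      simp_rw [smul_comm _ s, ← Finset.smul_sum] at hg
      exact (smul_eq_zero.1 hg).resolve_left hs
    have h1 : ∑ j, h (σ.symm j) • v j = 0 := by
      rw [← h0, ← Equiv.sum_comp σ]
      simp only [Equiv.symm_apply_apply]
    have h2 : ∀ j, h j = h (σ.symm (Fin.last 4)) := fun j => by
      simpa using hv.eq_last (g := fun j => h (σ.symm j)) h1 (σ j)
    have h3 := (h2 i.castSucc).trans (h2 (Fin.last 4)).symm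
    rwa [show h i.castSucc = g i from Fin.snoc_castSucc .., show h (Fin.last 4) = 0 from
      Fin.snoc_last ..] at h3
  · rw [← Finset.smul_sum, Equiv.sum_comp σ, hv.2, smul_zero]

theorem lineUnion_smul_comp (a : AG 4) (v : Fin 5 → AG 4) (σ : Equiv.Perm (Fin 5)) {s : ZMod 3}
    (hs : s ≠ 0) : lineUnion a (fun i => s • v (σ i)) = lineUnion a v := by
  ext x
  rw [mem_lineUnion, mem_lineUnion]
  constructor
  · rintro ⟨i, t, ht, rfl⟩
    exact ⟨σ i, t * s, mul_ne_zero ht hs, by rw [mul_smul]⟩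
  · rintro ⟨i, t, ht, rfl⟩
    exact ⟨σ.symm i, t * s, mul_ne_zero ht hs, by
      rw [mul_smul, smul_smul_self hs, Equiv.apply_symm_apply]⟩

/-- Each `w i` is plus or minus some `v j`. The zero sum of `w` is then a relation of `v` with these
signs as coefficients, so the signs agree by `IsFrame.eq_last`. -/
theorem IsFrame.exists_eq_smul_comp {v w : Fin 5 → AG 4} (hv : IsFrame v) (hw : IsFrame w)
    {a : AG 4} (h : lineUnion a w = lineUnion a v) :
    ∃ (σ : Equiv.Perm (Fin 5)) (s : ZMod 3), s ≠ 0 ∧ w = fun i => s • v (σ i) := by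
  have hmem : ∀ i, ∃ (j : Fin 5) (s : ZMod 3), s ≠ 0 ∧ w i = s • v j := fun i => by
    obtain ⟨j, s, hs, e⟩ := mem_lineUnion.1 (h ▸ mem_lineUnion.2 ⟨i, 1, one_ne_zero, rfl⟩)
    exact ⟨j, s, hs, by simpa using e⟩
  choose τ s hs hτ using hmem
  have hinj : Function.Injective τ := fun i j hij => by
    refine congrArg Prod.fst (hw.injective (hs i) (hs j) ?_)
    rw [hτ i, hτ j, smul_smul_self (hs i), smul_smul_self (hs j), hij]
  let σ : Equiv.Perm (Fin 5) := Equiv.ofBijective τ (Finite.injective_iff_bijective.1 hinj)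
  have hsum : ∑ j, s (σ.symm j) • v j = 0 := by
    rw [← hw.2, ← Equiv.sum_comp σ]
    refine Finset.sum_congr rfl fun i _ => ?_
    rw [Equiv.symm_apply_apply, hτ i]
    rfl
  refine ⟨σ, s (σ.symm (Fin.last 4)), hs _, funext fun i => ?_⟩
  have := hv.eq_last (g := fun j => s (σ.symm j)) hsum (σ i)
  rw [Equiv.symm_apply_apply] at this
  rw [← this, hτ i]
  rfl

/-- The count is `5! * 2`: a permutation and a common sign, which the distinctness of the ten
vectors `±v i` makes recoverable. -/
theorem IsFrame.ncard_eq_lineUnion {v : Fin 5 → AG 4} (hv : IsFrame v) (a : AG 4) :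
    {w | IsFrame w ∧ lineUnion a w = lineUnion a v}.ncard = 240 := by
  have e : {w | IsFrame w ∧ lineUnion a w = lineUnion a v} =
      (fun p : Equiv.Perm (Fin 5) × {s : ZMod 3 // s ≠ 0} => fun i => p.2.1 • v (p.1 i)) ''
        Set.univ := by
    ext w
    simp only [Set.mem_ofPred_eq, Set.image_univ, Set.mem_range]
    constructor
    · rintro ⟨hw, h⟩
      obtain ⟨σ, s, hs, rfl⟩ := hv.exists_eq_smul_comp hw h
      exact ⟨(σ, ⟨s, hs⟩), rfl⟩
    · rintro ⟨⟨σ, s, hs⟩, rfl⟩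
      exact ⟨hv.smul_comp σ hs, lineUnion_smul_comp a v σ hs⟩
  rw [e, Set.ncard_image_of_injective, Set.ncard_univ, Nat.card_prod, Nat.card_perm, Nat.card_fin,
    show Nat.card {s : ZMod 3 // s ≠ 0} = 2 by rw [Nat.card_eq_fintype_card]; rfl]
  · rfl
  · rintro ⟨σ, s, hs⟩ ⟨σ', s', hs'⟩ h
    have h' := fun i => hv.injective hs hs' (congrFun h i)
    obtain rfl : σ = σ' := Equiv.ext fun i => congrArg Prod.fst (h' i)
    obtain rfl : s = s' := congrArg Prod.snd (h' 0)
    rfl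

theorem isFrame_snoc_iff {u : Fin 4 → AG 4} :
    IsFrame (Fin.snoc u (-∑ i, u i)) ↔ LinearIndependent (ZMod 3) u := by
  simp only [IsFrame, Fin.sum_univ_castSucc (n := 4), Fin.snoc_castSucc, Fin.snoc_last,
    add_neg_cancel, and_true]

/-- Four independent vectors determine the fifth, so this is the number `80 * 78 * 72 * 54` of
ordered bases. -/
theorem ncard_isFrame : {v | IsFrame v}.ncard = 24261120 := by
  have e : {v | IsFrame v} = (fun u : Fin 4 → AG 4 => (Fin.snoc u (-∑ i, u i) : Fin 5 → AG 4)) ''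
      {u | LinearIndependent (ZMod 3) u} := by
    ext v
    constructor
    · intro hv
      refine ⟨fun i => v i.castSucc, hv.1, funext fun i => ?_⟩
      induction i using Fin.lastCases with
      | cast i => simp
      | last =>
        have := hv.2
        rw [Fin.sum_univ_castSucc] at this
        simp only [Fin.snoc_last]
        exact neg_eq_of_add_eq_zero_right this
    · rintro ⟨u, hu, rfl⟩
      exact isFrame_snoc_iff.2 hu
  rw [e, Set.ncard_image_of_injective, ← Nat.card_coe_set_eq]
  · refine (card_linearIndependent (K := ZMod 3) (V := AG 4) (k := 4) (by simp)).trans ?_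
    simp [Fin.prod_univ_succ, ZMod.card]
  · intro u u' h
    funext i
    simpa using congrFun h i.castSucc

theorem Set.ncard_image_mul_eq {α β : Type*} [Finite α] {f : α → β} {s : Set α} {n : ℕ}
    (h : ∀ x ∈ s, {y | y ∈ s ∧ f y = f x}.ncard = n) : (f '' s).ncard * n = s.ncard := by
  classical
  have := Fintype.ofFinite α
  rw [Set.ncard_eq_toFinset_card' s, Finset.card_eq_sum_card_image f,
    Finset.sum_const_nat (m := n), ← Set.ncard_coe_finset]
  · simp
  · intro D hD
    obtain ⟨x, hx, rfl⟩ := Finset.mem_image.1 hD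
    rw [← h x (Set.mem_toFinset.1 hx), ← Set.ncard_coe_finset]
    simp

theorem ncard_isDemicapWithAnchor (a : AG 4) :
    {D : Finset (AG 4) | IsDemicapWithAnchor a D}.ncard = 101088 := by
  have e : {D : Finset (AG 4) | IsDemicapWithAnchor a D} = lineUnion a '' {v | IsFrame v} := by
    ext D
    constructor
    · intro hD
      obtain ⟨v, hv, rfl⟩ := hD.exists_frame
      exact ⟨v, hv, rfl⟩
    · rintro ⟨v, hv, rfl⟩
      exact hv.isDemicapWithAnchor a
  have h := Set.ncard_image_mul_eq (f := lineUnion a) (s := {v | IsFrame v}) (n := 240)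
    fun v hv => IsFrame.ncard_eq_lineUnion hv a
  rw [ncard_isFrame] at h
  rw [e]
  exact Nat.eq_of_mul_eq_mul_right (by norm_num : 0 < 240) h

theorem mainTheorem7 :
    (∀ a : AG 4, {D : Finset (AG 4) | IsDemicapWithAnchor a D}.ncard = 101088) ∧
    (∀ C : Finset (AG 4), IsMaximalCap C →
      {D : Finset (AG 4) | IsDemicap D ∧ D ⊆ C}.ncard = 72) ∧
    (∀ D : Finset (AG 4), IsDemicap D →
      {C : Finset (AG 4) | IsMaximalCap C ∧ D ⊆ C}.ncard = 6) :=
  ⟨ncard_isDemicapWithAnchor, fun _ hC => hC.ncard_isDemicap, fun _ hD => hD.ncard_maximalCap⟩
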